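/- Let $k$ be a field, $G$ a group and $\mathcal C$ a small $k$-linear category, with set of objects $\mathcal C_0$ and morphism spaces ${}_y\mathcal C_x$ (from $x$ to $y$), on which $G$ acts by $k$-linear automorphisms. Assume that the action on objects is free: $sx=x$ with $s\in G$, $x\in\mathcal C_0$ implies $s=1$. For a $k$-linear category $\mathcal B$ let $C_\bullet(\mathcal B)$ be the Hochschild–Mitchell complex, $C_n(\mathcal B)=\bigoplus_{x_0,\dots,x_n}{}_{x_0}\mathcal B_{x_n}\otimes_k\cdots\otimes_k{}_{x_1}\mathcal B_{x_0}$ with $$d(f_n\otimes\cdots\otimes f_0)=\sum_{j=0}^{n-1}(-1)^j f_n\otimes\cdots\otimes f_{n-j}f_{n-j-1}\otimes\cdots\otimes f_0+(-1)^n f_0f_n\otimes f_{n-1}\otimes\cdots\otimes f_1 ,$$ and let $HH_*(\mathcal B)$ be its homology. If $\mathcal B$ is $G$-graded, let $C^{\{1\}}_\bullet(\mathcal B)\subseteq C_\bullet(\mathcal B)$ be the subcomplex spanned by the $f_n\otimes\cdots\otimes f_0$ with $f_i$ homogeneous of degree $s_i$ and $s_n\cdots s_1s_0=1$, and let $HH^{\{1\}}_*(\mathcal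 B)$ be its homology. The group $G$ acts on $C_\bullet(\mathcal C)$ by $s(f_n\otimes\cdots\otimes f_0)=sf_n\otimes\cdots\otimes sf_0$, and $M_G$ denotes the coinvariants of a $kG$-module $M$. The skew category $\mathcal C[G]$ has objects $\mathcal C_0$ and $G$-graded morphism spaces ${}_y\mathcal C[G]_x=\bigoplus_{s\in G}{}_y\mathcal C_{sx}$, where the summand ${}_y\mathcal C_{sx}$ has degree $s$; the composite of $f\in{}_y\mathcal C_{sx}$ and $g\in{}_z\mathcal C_{ty}$ is $g\circ(tf)\in{}_z\mathcal C_{tsx}$. Then: 1. Let $T\subseteq\mathcal C_0$ contain exactly one element of each $G$-orbit, and let $\mathcal C_T[G]$ be the full subcategory of $\mathcal C[G]$ on $T$. There is an isomorphism of chain complexes $A: C_\bullet(\mathcal C)_G\to C^{\{1\}}_\bullet(\mathcal C_T[G])$ such that, for all $n\ge 0$, $u_0,\dots,u_n\in T$, $s_0,\dots,s_n\in G$ and $f_i\in{}_{s_{i+1}u_{i+1}}\mathcal C_{s_iu_i}$ (indices modulo $n+1$), the class of $f_n\otimes\cdots\otimes f_0$ is sent to $g_n\otimes\cdots\otimes g_0$,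 where $g_i=s_{i+1}^{-1}f_i\in{}_{u_{i+1}}\mathcal C_{s_{i+1}^{-1}s_iu_i}$ is regarded as a morphism $u_i\to u_{i+1}$ of degree $s_{i+1}^{-1}s_i$. Moreover the inclusion $\mathcal C_T[G]\subseteq\mathcal C[G]$ induces a quasi-isomorphism $C^{\{1\}}_\bullet(\mathcal C_T[G])\to C^{\{1\}}_\bullet(\mathcal C[G])$. 2. For every $n\ge 0$ there is an isomorphism of $k$-vector spaces $HH^{\{1\}}_n(\mathcal C[G])\cong H_n\big(C_\bullet(\mathcal C)_G\big)$. 3. If the coinvariants functor from $kG$-modules to $k$-vector spaces is exact, then for every $n\ge 0$ there is an isomorphism of $k$-vector spaces $HH^{\{1\}}_n(\mathcal C[G])\cong HH_n(\mathcal C)_G$. -/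

import Mathlib

open CategoryTheory
open scoped TensorProduct DirectSum

universe u

namespace HochschildMitchell

section ClosedPaths

variable {B : Type u} [SmallCategory B] {n : ℕ}

/-- The morphism `f a : x a ⟶ x (a + 1)` of a closed path, with target written `x b` when
`a + 1 = b`. -/
def edge {x : Fin (n + 1) → B} (f : ∀ i, x i ⟶ x (i + 1)) {a b : Fin (n + 1)} (h : a + 1 = b) :
    x a ⟶ x b :=
  f a ≫ eqToHom (congrArg x h)

theorem succAbove_add_one_of_eq {v : Fin (n + 2)} {i : Fin (n + 1)} (h : v.succAbove i + 1 = v) :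
    v + 1 = v.succAbove (i + 1) := by
  rw [Fin.ext_iff] at *
  simp only [Fin.succAbove, Fin.lt_def, Fin.val_add_one, Fin.ext_iff, Fin.val_last] at *
  split_ifs at * <;> simp only [Fin.val_add_one, Fin.ext_iff, Fin.val_last, Fin.val_castSucc, Fin.val_succ] at * <;> split_ifs at * <;> omega

theorem succAbove_add_one_of_ne {v : Fin (n + 2)} {i : Fin (n + 1)} (h : v.succAbove i + 1 ≠ v) :
    v.succAbove i + 1 = v.succAbove (i + 1) := by
  rw [Ne, Fin.ext_iff] at h
  rw [Fin.ext_iff]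
  simp only [Fin.succAbove, Fin.lt_def, Fin.val_add_one, Fin.ext_iff, Fin.val_last] at *
  split_ifs at * <;> simp only [Fin.val_add_one, Fin.ext_iff, Fin.val_last, Fin.val_castSucc, Fin.val_succ] at * <;> split_ifs at * <;> omega

open Classical in
/-- The closed path obtained by deleting the vertex `x v`: the two morphisms that meet at `x v`
are replaced by their composite. -/
noncomputable def face (v : Fin (n + 2)) {x : Fin (n + 2) → B} (f : ∀ i, x i ⟶ x (i + 1))
    (i : Fin (n + 1)) : x (v.succAbove i) ⟶ x (v.succAbove (i + 1)) :=
  if h : v.succAbove i + 1 = v then edge f h ≫ edge f (succAbove_add_one_of_eq h)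
  else edge f (succAbove_add_one_of_ne h)

/-- `Walk f S a b g`: `g` is the composite of consecutive morphisms of `f`, starting at `x a`,
ending at `x b`, with all intermediate indices in `S`. -/
inductive Walk {x : Fin (n + 1) → B} (f : ∀ i, x i ⟶ x (i + 1)) (S : Set (Fin (n + 1))) :
    ∀ a b : Fin (n + 1), (x a ⟶ x b) → Prop
  | edge {a b : Fin (n + 1)} (h : a + 1 = b) : Walk f S a b (edge f h)
  | cons {a m b : Fin (n + 1)} (h : a + 1 = m) (hm : m ∈ S) {g : x m ⟶ x b}
      (hg : Walk f S m b g) : Walk f S a b (HochschildMitchell.edge f h ≫ g)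

theorem Walk.unique {x : Fin (n + 1) → B} {f : ∀ i, x i ⟶ x (i + 1)} {S : Set (Fin (n + 1))}
    {a b : Fin (n + 1)} {g g' : x a ⟶ x b} (hb : b ∉ S) (h : Walk f S a b g)
    (h' : Walk f S a b g') : g = g' := by
  induction h with
  | edge h =>
    cases h' with
    | edge h' => rfl
    | cons h' hm hg => subst h; subst h'; exact absurd hm hb
  | cons h hm hg ih =>
    cases h' with
    | edge h' => subst h; subst h'; exact absurd hm hb
    | cons h' hm' hg' => subst h; subst h'; rw [ih hb hg']

theorem Walk.mono {x : Fin (n + 1) → B} {f : ∀ i, x i ⟶ x (i + 1)} {S S' : Set (Fin (n + 1))}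
    (hS : S ⊆ S') {a b : Fin (n + 1)} {g : x a ⟶ x b} (h : Walk f S a b g) :
    Walk f S' a b g := by
  induction h with
  | edge h => exact .edge h
  | cons h hm hg ih => exact .cons h (hS hm) ih

theorem Walk.trans {x : Fin (n + 1) → B} {f : ∀ i, x i ⟶ x (i + 1)} {S : Set (Fin (n + 1))}
    {a m b : Fin (n + 1)} {g : x a ⟶ x m} {g' : x m ⟶ x b} (hm : m ∈ S) (h : Walk f S a m g)
    (h' : Walk f S m b g') : Walk f S a b (g ≫ g') := by
  induction h with
  | edge h => exact .cons h hm h'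
  | cons h hm' hg ih => rw [Category.assoc]; exact .cons h hm' (ih hm h')

theorem walk_face (v : Fin (n + 2)) {x : Fin (n + 2) → B} (f : ∀ i, x i ⟶ x (i + 1))
    (i : Fin (n + 1)) : Walk f {v} (v.succAbove i) (v.succAbove (i + 1)) (face v f i) := by
  unfold face
  split_ifs with h
  · exact Walk.cons h (Set.mem_singleton v) (Walk.edge _)
  · exact Walk.edge _

theorem Walk.of_face (v : Fin (n + 2)) {x : Fin (n + 2) → B} {f : ∀ i, x i ⟶ x (i + 1)}
    {S : Set (Fin (n + 1))} {a b : Fin (n + 1)}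
    {g : (fun i => x (v.succAbove i) : Fin (n + 1) → B) a ⟶
      (fun i => x (v.succAbove i) : Fin (n + 1) → B) b}
    (h : Walk (x := fun i => x (v.succAbove i)) (face v f) S a b g) :
    Walk f (insert v (v.succAbove '' S)) (v.succAbove a) (v.succAbove b) g := by
  refine Walk.rec (motive := fun a b g _ =>
    Walk f (insert v (v.succAbove '' S)) (v.succAbove a) (v.succAbove b) g) ?_ ?_ h
  · intro a b h
    subst h
    simpa [HochschildMitchell.edge] using (walk_face v f _).mono (by simp)
  · intro a m b h hm g hg ih
    subst h
    refine Walk.trans (Set.mem_insert_of_mem _ ⟨_, hm, rfl⟩) ?_ ih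
    simpa [HochschildMitchell.edge] using (walk_face v f _).mono (by simp)

end ClosedPaths

section Chains

variable (k : Type u) [CommRing k] (B : Type u) [SmallCategory B] [Preadditive B] [Linear k B]

/-- The module of Hochschild-Mitchell `n`-chains: the direct sum, over all families
`x 0, …, x n` of objects, of the tensor products of the morphism modules
`x 0 ⟶ x 1`, …, `x (n - 1) ⟶ x n`, `x n ⟶ x 0` (indices are modulo `n + 1`). -/
abbrev Chain (n : ℕ) : Type u :=
  ⨁ x : Fin (n + 1) → B, ⨂[k] i : Fin (n + 1), (x i ⟶ x (i + 1))

variable {B} {n : ℕ}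

open Classical in
/-- The elementary chain `f n ⊗ ⋯ ⊗ f 1 ⊗ f 0`. -/
noncomputable def tens {x : Fin (n + 1) → B} (f : ∀ i, x i ⟶ x (i + 1)) : Chain k B n :=
  DirectSum.lof k (Fin (n + 1) → B) (fun x => ⨂[k] i : Fin (n + 1), (x i ⟶ x (i + 1))) x
    (PiTensorProduct.tprod k f)

open Classical in
/-- The linear map on chains determined by multilinear maps on families of morphisms. -/
noncomputable def liftChain {M : Type*} [AddCommGroup M] [Module k M]
    (φ : ∀ x : Fin (n + 1) → B, MultilinearMap k (fun i => (x i ⟶ x (i + 1))) M) :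
    Chain k B n →ₗ[k] M :=
  DirectSum.toModule k (Fin (n + 1) → B) M fun x => PiTensorProduct.lift (φ x)

@[simp]
theorem liftChain_tens {M : Type*} [AddCommGroup M] [Module k M]
    (φ : ∀ x : Fin (n + 1) → B, MultilinearMap k (fun i => (x i ⟶ x (i + 1))) M)
    {x : Fin (n + 1) → B} (f : ∀ i, x i ⟶ x (i + 1)) :
    liftChain k φ (tens k f) = φ x f := by
  simp [liftChain, tens]

variable {k} in
theorem chain_hom_ext {M : Type*} [AddCommGroup M] [Module k M] {φ ψ : Chain k B n →ₗ[k] M}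
    (h : ∀ (x : Fin (n + 1) → B) (f : ∀ i, x i ⟶ x (i + 1)), φ (tens k f) = ψ (tens k f)) :
    φ = ψ := by
  classical
  refine DirectSum.linearMap_ext k fun x => PiTensorProduct.ext (MultilinearMap.ext fun f => ?_)
  simpa [tens] using h x f

theorem tens_congr {x x' : Fin (n + 1) → B} (hx : x = x') (f : ∀ i, x i ⟶ x (i + 1))
    (f' : ∀ i, x' i ⟶ x' (i + 1))
    (hf : ∀ i, f i = eqToHom (congrFun hx i) ≫ f' i ≫ eqToHom (congrFun hx (i + 1)).symm) :
    tens k f = tens k f' := by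
  subst hx
  congr 1
  funext i
  simpa using hf i

open Classical in
theorem exists_face_update (v : Fin (n + 2)) (j : Fin (n + 2)) :
    ∃ i₀ : Fin (n + 1), (v.succAbove i₀ = j ∧ v ≠ j ∨ j = v ∧ v.succAbove i₀ + 1 = v) := by
  by_cases h : j = v
  · have hv : v - 1 ≠ v := by simp
    obtain ⟨i, hi⟩ := Fin.exists_succAbove_eq hv
    exact ⟨i, .inr ⟨h, by rw [hi, sub_add_cancel]⟩⟩
  · obtain ⟨i, hi⟩ := Fin.exists_succAbove_eq h
    exact ⟨i, .inl ⟨hi, Ne.symm h⟩⟩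

/-- The linear dependence of `face` on each of the morphisms of the closed path. -/
theorem exists_face_update_linear [DecidableEq (Fin (n + 2))] (v : Fin (n + 2))
    {x : Fin (n + 2) → B} (f : ∀ i, x i ⟶ x (i + 1)) (j : Fin (n + 2)) :
    ∃ (i₀ : Fin (n + 1))
      (l : (x j ⟶ x (j + 1)) →ₗ[k] (x (v.succAbove i₀) ⟶ x (v.succAbove (i₀ + 1)))),
      ∀ a, face v (Function.update f j a) = Function.update (face v f) i₀ (l a) := by
  obtain ⟨i₀, ⟨rfl, hj⟩ | ⟨rfl, hj⟩⟩ := exists_face_update v j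
  · by_cases h : v.succAbove i₀ + 1 = v
    · refine ⟨i₀, Linear.rightComp k _ (eqToHom (congrArg x h) ≫
        edge f (succAbove_add_one_of_eq h)), fun a => ?_⟩
      funext i
      rcases eq_or_ne i i₀ with rfl | hi
      · simp [face, h, edge, hj]
      · have : v.succAbove i ≠ v.succAbove i₀ := fun e => hi (Fin.succAbove_right_injective e)
        simp [face, edge, hi, hj, this]
    · refine ⟨i₀, Linear.rightComp k _ (eqToHom (congrArg x (succAbove_add_one_of_ne h))),
        fun a => ?_⟩
      funext i
      rcases eq_or_ne i i₀ with rfl | hi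
      · simp [face, h, edge]
      · have : v.succAbove i ≠ v.succAbove i₀ := fun e => hi (Fin.succAbove_right_injective e)
        simp [face, edge, hi, hj, this]
  · refine ⟨i₀, (Linear.leftComp k _ (edge f hj)).comp
      (Linear.rightComp k _ (eqToHom (congrArg x (succAbove_add_one_of_eq hj)))), fun a => ?_⟩
    funext i
    rcases eq_or_ne i i₀ with rfl | hi
    · simp [face, hj, edge, Fin.succAbove_ne]
    · have : ¬ j.succAbove i + 1 = j := fun e =>
        hi (Fin.succAbove_right_injective (add_right_cancel (e.trans hj.symm)))
      simp [face, edge, hi, this, Fin.succAbove_ne]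

/-- The `v`-th face map on chains. -/
noncomputable def faceMap (v : Fin (n + 2)) : Chain k B (n + 1) →ₗ[k] Chain k B n :=
  liftChain k fun x =>
    { toFun := fun f => tens k (x := fun i => x (v.succAbove i)) (face v f)
      map_update_add' := fun f j a b => by
        classical
        obtain ⟨i₀, l, h⟩ := exists_face_update_linear k v f j
        simp only [h, map_add, tens, MultilinearMap.map_update_add]
      map_update_smul' := fun f j c a => by
        classical
        obtain ⟨i₀, l, h⟩ := exists_face_update_linear k v f j
        simp only [h, map_smul, tens, MultilinearMap.map_update_smul] }

@[simp]
theorem faceMap_tens (v : Fin (n + 2)) {x : Fin (n + 2) → B} (f : ∀ i, x i ⟶ x (i + 1)) :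
    faceMap k v (tens k f) = tens k (x := fun i => x (v.succAbove i)) (face v f) := by
  simp [faceMap]

theorem tens_eq_of_walk {m : ℕ} {x : Fin (m + 1) → B} (f : ∀ i, x i ⟶ x (i + 1))
    {S : Set (Fin (m + 1))} {φ φ' : Fin (n + 1) → Fin (m + 1)} (hφ : φ = φ') (hS : ∀ i, φ i ∉ S)
    (g : ∀ i, x (φ i) ⟶ x (φ (i + 1))) (g' : ∀ i, x (φ' i) ⟶ x (φ' (i + 1)))
    (hg : ∀ i, Walk f S _ _ (g i)) (hg' : ∀ i, Walk f S _ _ (g' i)) :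
    tens k (x := fun i => x (φ i)) g = tens k (x := fun i => x (φ' i)) g' := by
  subst hφ
  congr 1
  funext i
  exact (hg i).unique (hS _) (hg' i)

theorem faceMap_faceMap (v : Fin (n + 3)) (w : Fin (n + 2)) (c : Chain k B (n + 2)) :
    faceMap k w (faceMap k v c) =
      faceMap k (w.predAbove v) (faceMap k (v.succAbove w) c) := by
  suffices (faceMap k w).comp (faceMap (B := B) k v) =
      (faceMap k (w.predAbove v)).comp (faceMap k (v.succAbove w)) from LinearMap.congr_fun this c
  refine chain_hom_ext fun x f => ?_
  simp only [LinearMap.comp_apply, faceMap_tens]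
  have e := Fin.succAbove_succAbove_predAbove v w
  refine tens_eq_of_walk k f (S := {v, v.succAbove w})
    (φ := fun i => v.succAbove (w.succAbove i))
    (φ' := fun i => (v.succAbove w).succAbove ((w.predAbove v).succAbove i)) ?_ ?_ _ _ ?_ ?_
  · funext i
    exact (Fin.succAbove_succAbove_succAbove_predAbove v w i).symm
  · intro i
    simp [Fin.succAbove_ne, Fin.succAbove_right_injective.eq_iff]
  · intro i
    refine (Walk.of_face v (walk_face w _ i)).mono ?_
    simp
  · intro i
    refine (Walk.of_face (v.succAbove w) (walk_face (w.predAbove v) _ i)).mono ?_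
    simp [e, Set.pair_comm v]

/-- The Hochschild-Mitchell boundary map
`d (f (n+1) ⊗ ⋯ ⊗ f 0) = f (n+1) f n ⊗ f (n-1) ⊗ ⋯ ⊗ f 0 - f (n+1) ⊗ f n f (n-1) ⊗ ⋯ ⊗ f 0 + ⋯
+ (-1) ^ (n+1) f 0 f (n+1) ⊗ f n ⊗ ⋯ ⊗ f 1`. -/
noncomputable def boundary (n : ℕ) : Chain k B (n + 1) →ₗ[k] Chain k B n :=
  ∑ v : Fin (n + 2), ((-1 : k) ^ (v.rev : ℕ)) • faceMap k v

theorem boundary_boundary (n : ℕ) (c : Chain k B (n + 2)) :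
    boundary k n (boundary k (n + 1) c) = 0 := by
  simp only [boundary, LinearMap.sum_apply, LinearMap.smul_apply, map_sum, map_smul,
    smul_smul, Finset.smul_sum]
  rw [← Finset.sum_product']
  refine Finset.sum_involution (fun p _ => (p.1.succAbove p.2, p.2.predAbove p.1)) ?_ ?_ ?_ ?_
  · rintro ⟨v, w⟩ -
    rw [faceMap_faceMap k v w c, ← add_smul]
    have h := Fin.neg_one_pow_succAbove_add_predAbove (R := k) v w
    have h1 : ∀ (a : Fin (n + 3)) (b : Fin (n + 2)),
        (-1 : k) ^ (a.rev : ℕ) * (-1) ^ (b.rev : ℕ) = - (-1) ^ (a + b : ℕ) := by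
      intro a b
      rw [← pow_add, ← neg_one_mul (_ ^ _), ← pow_succ']
      refine neg_one_pow_congr ?_
      simp only [Fin.val_rev, Nat.even_iff]
      omega
    rw [h1, h1, h, neg_neg, neg_add_cancel, zero_smul]
  · rintro ⟨v, w⟩ - - e
    exact Fin.succAbove_ne v w (Prod.ext_iff.1 e).1
  · simp
  · rintro ⟨v, w⟩ -
    refine Prod.ext (Fin.succAbove_succAbove_predAbove v w) ?_
    exact Fin.predAbove_predAbove_succAbove v w

end Chains

section MapChain

variable {k : Type u} [CommRing k] {B B' : Type u} [SmallCategory B] [Preadditive B] [Linear k B]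
  [SmallCategory B'] [Preadditive B'] [Linear k B'] {n : ℕ}

/-- The map on chains `f n ⊗ ⋯ ⊗ f 0 ↦ m (f n) ⊗ ⋯ ⊗ m (f 0)` induced by a map on objects and
linear maps on morphisms. -/
noncomputable def mapChain (φ : B → B') (m : ∀ x y : B, (x ⟶ y) →ₗ[k] (φ x ⟶ φ y)) (n : ℕ) :
    Chain k B n →ₗ[k] Chain k B' n :=
  liftChain k fun x =>
    { toFun := fun f => tens k (x := fun i => φ (x i)) fun i => m _ _ (f i)
      map_update_add' := fun f j a b => by
        have h : ∀ c, (fun i => m _ _ (Function.update f j c i)) =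
            Function.update (fun i => m _ _ (f i)) j (m _ _ c) := fun c => by
          funext i
          exact Function.apply_update (fun i => m (x i) (x (i + 1))) f j c i
        simp only [h, map_add, tens, MultilinearMap.map_update_add]
      map_update_smul' := fun f j c a => by
        have h : ∀ c, (fun i => m _ _ (Function.update f j c i)) =
            Function.update (fun i => m _ _ (f i)) j (m _ _ c) := fun c => by
          funext i
          exact Function.apply_update (fun i => m (x i) (x (i + 1))) f j c i
        simp only [h, map_smul, tens, MultilinearMap.map_update_smul] }

@[simp]
theorem mapChain_tens (φ : B → B') (m : ∀ x y : B, (x ⟶ y) →ₗ[k] (φ x ⟶ φ y))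
    {x : Fin (n + 1) → B} (f : ∀ i, x i ⟶ x (i + 1)) :
    mapChain φ m n (tens k f) = tens k (x := fun i => φ (x i)) fun i => m _ _ (f i) := by
  simp [mapChain]

theorem map_edge (φ : B → B') (m : ∀ x y : B, (x ⟶ y) →ₗ[k] (φ x ⟶ φ y))
    {x : Fin (n + 1) → B} (f : ∀ i, x i ⟶ x (i + 1)) {a b : Fin (n + 1)} (h : a + 1 = b) :
    m _ _ (edge f h) = edge (x := fun i => φ (x i)) (fun i => m _ _ (f i)) h := by
  subst h
  simp [edge]

theorem mapChain_boundary (φ : B → B') (m : ∀ x y : B, (x ⟶ y) →ₗ[k] (φ x ⟶ φ y))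
    (hm : ∀ {x y z : B} (f : x ⟶ y) (g : y ⟶ z), m _ _ (f ≫ g) = m _ _ f ≫ m _ _ g) (n : ℕ)
    (c : Chain k B (n + 1)) :
    mapChain φ m n (boundary k n c) = boundary k n (mapChain φ m (n + 1) c) := by
  suffices h : ∀ v, (mapChain φ m n).comp (faceMap k v) =
      (faceMap k v).comp (mapChain φ m (n + 1)) by
    simp only [boundary, LinearMap.sum_apply, LinearMap.smul_apply, map_sum, map_smul]
    exact Finset.sum_congr rfl fun v _ => congrArg _ (LinearMap.congr_fun (h v) c)
  refine fun v => chain_hom_ext fun x f => ?_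
  simp only [LinearMap.comp_apply, faceMap_tens, mapChain_tens]
  congr 1
  funext i
  unfold face
  split_ifs with h
  · rw [hm, map_edge, map_edge]
  · rw [map_edge]

end MapChain

section Grading

variable (k : Type u) [CommRing k] (G : Type u) [Group G]

open Classical in
/-- A `G`-grading of a `k`-linear category: a direct sum decomposition of each morphism module,
compatible with composition. -/
structure Grading (B : Type u) [SmallCategory B] [Preadditive B] [Linear k B] where
  /-- The morphisms from `x` to `y` that are homogeneous of degree `s`. -/
  part : ∀ x y : B, G → Submodule k (x ⟶ y)
  isInternal : ∀ x y : B, DirectSum.IsInternal (part x y)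
  comp_mem : ∀ {x y z : B} {s t : G} {f : x ⟶ y} {g : y ⟶ z},
    f ∈ part x y s → g ∈ part y z t → f ≫ g ∈ part x z (t * s)

variable {k G}
variable {B : Type u} [SmallCategory B] [Preadditive B] [Linear k B]

/-- The product `s n * ⋯ * s 1 * s 0`. -/
def revProd {n : ℕ} (s : Fin n → G) : G := (List.ofFn s).reverse.prod

theorem revProd_succ {n : ℕ} (s : Fin (n + 1) → G) :
    revProd s = revProd (fun i => s i.succ) * s 0 := by
  simp [revProd, List.ofFn_succ]

theorem revProd_succ' {n : ℕ} (s : Fin (n + 1) → G) :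
    revProd s = s (Fin.last n) * revProd (fun i : Fin n => s i.castSucc) := by
  simp only [revProd]
  rw [List.ofFn_succ']
  simp [List.concat_eq_append]

/-- The degrees of the morphisms of `face v f` when `f i` has degree `s i`. -/
def faceDeg {n : ℕ} (v : Fin (n + 2)) (s : Fin (n + 2) → G) (i : Fin (n + 1)) : G :=
  if v.succAbove i + 1 = v then s v * s (v.succAbove i) else s (v.succAbove i)

theorem revProd_faceDeg_zero {n : ℕ} (s : Fin (n + 2) → G) :
    revProd (faceDeg 0 s) = s 0 * revProd s * (s 0)⁻¹ := by
  rw [revProd_succ' (faceDeg 0 s), revProd_succ s, revProd_succ' (fun i : Fin (n + 1) => s i.succ)]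
  have h1 : faceDeg 0 s (Fin.last n) = s 0 * s (Fin.last n).succ := by
    simp [faceDeg]
  have h2 : (fun i : Fin n => faceDeg 0 s i.castSucc) = fun i => s i.castSucc.succ := by
    funext i
    have : (i.castSucc.succ : Fin (n + 2)) + 1 ≠ 0 := by
      intro h
      have h' := congrArg Fin.val h
      rw [Fin.val_add_one] at h'
      simp [Fin.ext_iff] at h'
      omega
    simp [faceDeg, this]
  rw [h1, h2]
  simp [mul_assoc]

theorem revProd_faceDeg_succ {n : ℕ} (j : Fin (n + 1)) (s : Fin (n + 2) → G) :
    revProd (faceDeg j.succ s) = revProd s := by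
  have h0 : faceDeg j.succ s = Fin.contractNth j.castSucc (fun a b => b * a) s := by
    funext i
    rcases lt_trichotomy i j with h | h | h
    · rw [Fin.contractNth_apply_of_lt _ _ _ _ h, faceDeg, Fin.succAbove_of_castSucc_lt _ _
        (Fin.castSucc_lt_succ_iff.2 h.le), if_neg]
      simp only [Fin.coeSucc_eq_succ, Fin.succ_inj]
      exact h.ne
    · subst h
      simp [faceDeg, Fin.contractNth_apply_of_eq]
    · rw [Fin.contractNth_apply_of_gt _ _ _ _ h, faceDeg, Fin.succAbove_of_lt_succ _ _
        (Fin.succ_lt_succ_iff.2 h), if_neg]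
      rw [Fin.ext_iff, Fin.val_add_one]
      have := i.2
      have h' : (j : ℕ) < i := h
      split_ifs <;> simp only [Fin.val_succ] <;> omega
  have key : ∀ {m : ℕ} (t : Fin m → G),
      MulOpposite.op (revProd t) = Fin.partialProd (fun i => MulOpposite.op (t i)) (Fin.last m) := by
    intro m t
    simp [revProd, Fin.partialProd, MulOpposite.op_list_prod, List.map_reverse, Function.comp_def,
      List.take_of_length_le]
  apply MulOpposite.op_injective
  rw [h0, key, key]
  have h1 := congrFun (Fin.partialProd_contractNth (fun i => MulOpposite.op (s i)) j.castSucc)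
    (Fin.last (n + 1))
  have h2 : (j.castSucc.succ).succAbove (Fin.last (n + 1)) = Fin.last (n + 2) := by
    rw [Fin.succ_castSucc, Fin.succAbove_of_le_castSucc]
    · simp
    · exact Fin.castSucc_le_castSucc_iff.2 (Fin.le_last _)
  rw [Function.comp_apply, h2] at h1
  rw [← h1]
  congr 1
  funext i
  simp only [Fin.contractNth]
  split_ifs <;> simp

theorem conj_faceDeg {n : ℕ} (v : Fin (n + 2)) (s : Fin (n + 2) → G) :
    ConjClasses.mk (revProd (faceDeg v s)) = ConjClasses.mk (revProd s) := by
  rw [ConjClasses.mk_eq_mk_iff_isConj]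
  rcases Fin.eq_zero_or_eq_succ v with rfl | ⟨j, rfl⟩
  · rw [revProd_faceDeg_zero]
    exact (isConj_iff.2 ⟨s 0, rfl⟩).symm
  · rw [revProd_faceDeg_succ]

namespace Grading

variable (γ : Grading k G B) (D : ConjClasses G)

/-- The elementary chains `f n ⊗ ⋯ ⊗ f 0` with every `f i` homogeneous and the product
`s n * ⋯ * s 0` of the degrees in the conjugacy class `D`. -/
def homogeneousTens (n : ℕ) : Set (Chain k B n) :=
  {c | ∃ (x : Fin (n + 1) → B) (s : Fin (n + 1) → G) (f : ∀ i, x i ⟶ x (i + 1)),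
    (∀ i, f i ∈ γ.part _ _ (s i)) ∧ ConjClasses.mk (revProd s) = D ∧ c = tens k f}

/-- The submodule of chains of class `D`. -/
def classChain (n : ℕ) : Submodule k (Chain k B n) :=
  Submodule.span k (γ.homogeneousTens D n)

theorem edge_mem {n : ℕ} {x : Fin (n + 1) → B} {s : Fin (n + 1) → G} {f : ∀ i, x i ⟶ x (i + 1)}
    (hf : ∀ i, f i ∈ γ.part _ _ (s i)) {a b : Fin (n + 1)} (h : a + 1 = b) :
    edge f h ∈ γ.part _ _ (s a) := by
  subst h
  simpa [edge] using hf a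

theorem boundary_mem {n : ℕ} {c : Chain k B (n + 1)} (hc : c ∈ γ.classChain D (n + 1)) :
    boundary k n c ∈ γ.classChain D n := by
  refine (Submodule.span_le (p := (γ.classChain D n).comap (boundary k n))).2 ?_ hc
  rintro _ ⟨x, s, f, hf, hD, rfl⟩
  simp only [Submodule.comap_coe, Set.mem_preimage, SetLike.mem_coe, boundary, LinearMap.sum_apply,
    LinearMap.smul_apply, faceMap_tens]
  refine Submodule.sum_mem _ fun v _ => Submodule.smul_mem _ _ (Submodule.subset_span
    ⟨_, faceDeg v s, face v f, fun i => ?_, (conj_faceDeg v s).trans hD, rfl⟩)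
  unfold face faceDeg
  split_ifs with h
  · exact γ.comp_mem (γ.edge_mem hf h) (γ.edge_mem hf _)
  · exact γ.edge_mem hf _

/-- The complex of chains of class `D` of a graded category. -/
noncomputable def classComplex : ChainComplex (ModuleCat.{u} k) ℕ :=
  ChainComplex.of (fun n => ModuleCat.of k (γ.classChain D n))
    (fun n => ModuleCat.ofHom ((boundary k n).restrict fun _ hc => γ.boundary_mem D hc))
    (fun n => by
      refine ModuleCat.hom_ext (LinearMap.ext fun c => Subtype.ext ?_)
      exact boundary_boundary k n c.1)

theorem classComplex_d (n : ℕ) : (γ.classComplex D).d (n + 1) n =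
    ModuleCat.ofHom ((boundary k n).restrict fun _ hc => γ.boundary_mem D hc) := by
  unfold classComplex
  simp

/-- The inclusion of the chains of class `D` into all chains. -/
noncomputable def toChain (n : ℕ) : (γ.classComplex D).X n →ₗ[k] Chain k B n :=
  (γ.classChain D n).subtype

/-- The summand of class `D` of the Hochschild-Mitchell homology of a graded category. -/
noncomputable def classHomology (n : ℕ) : ModuleCat.{u} k := (γ.classComplex D).homology n

/-- The grading induced on a full subcategory. -/
def restrict (P : ObjectProperty B) : Grading k G P.FullSubcategory where
  part x y s := (γ.part x.obj y.obj s).comap (P.ι.mapLinearMap k)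
  isInternal x y := by
    classical
    let e : (x ⟶ y) ≃ₗ[k] (x.obj ⟶ y.obj) :=
      LinearEquiv.ofBijective (P.ι.mapLinearMap k) (P.fullyFaithfulι.map_bijective x y)
    have h := (DirectSum.isInternal_submodule_iff_iSupIndep_and_iSup_eq_top _).1
      (γ.isInternal x.obj y.obj)
    refine (DirectSum.isInternal_submodule_iff_iSupIndep_and_iSup_eq_top _).2 ⟨?_, ?_⟩
    · exact h.1.map_orderIso (Submodule.orderIsoMapComap e).symm
    · exact ((Submodule.orderIsoMapComap e).symm.map_iSup _).symm.trans
        ((congrArg _ h.2).trans (Submodule.orderIsoMapComap e).symm.map_top)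
  comp_mem hf hg := γ.comp_mem hf hg

/-- The map of class complexes induced by the inclusion of a full subcategory. -/
noncomputable def inclusion (P : ObjectProperty B) :
    (γ.restrict P).classComplex D ⟶ γ.classComplex D :=
  ChainComplex.ofHom
    (fun n => ModuleCat.ofHom ((mapChain P.ι.obj (fun _ _ => P.ι.mapLinearMap k) n).restrict
      (p := (γ.restrict P).classChain D n) (q := γ.classChain D n) fun c hc => by
        refine (Submodule.span_le (p := (γ.classChain D n).comap
          (mapChain P.ι.obj (fun _ _ => P.ι.mapLinearMap k) n))).2 ?_ hc
        rintro _ ⟨x, s, f, hf, hD, rfl⟩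
        simp only [Submodule.comap_coe, Set.mem_preimage, SetLike.mem_coe, mapChain_tens]
        exact Submodule.subset_span ⟨_, s, _, hf, hD, rfl⟩))
    (fun n => by
      rw [classComplex_d, classComplex_d]
      refine ModuleCat.hom_ext (LinearMap.ext fun c => Subtype.ext ?_)
      exact (mapChain_boundary P.ι.obj (fun _ _ => P.ι.mapLinearMap k)
        (fun _ _ => P.ι.map_comp _ _) n c.1).symm)

end Grading
end Grading

section Action

variable (k : Type u) [CommRing k] (G : Type u) [Group G]

/-- A linear action of `G` on a `k`-linear category, over a given action of `G` on the objects: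
every `s : G` sends a morphism `f : x ⟶ y` to a morphism `homMap s f : s • x ⟶ s • y`. -/
class LinearAction (C : Type u) [SmallCategory C] [Preadditive C] [Linear k C]
    [MulAction G C] where
  /-- The action of `s : G` on morphisms. -/
  homMap : ∀ (s : G) {x y : C}, (x ⟶ y) →ₗ[k] (s • x ⟶ s • y)
  homMap_id : ∀ (s : G) (x : C), homMap s (𝟙 x) = 𝟙 (s • x)
  homMap_comp : ∀ (s : G) {x y z : C} (f : x ⟶ y) (g : y ⟶ z),
    homMap s (f ≫ g) = homMap s f ≫ homMap s g
  homMap_one : ∀ {x y : C} (f : x ⟶ y),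
    homMap 1 f = eqToHom (one_smul G x) ≫ f ≫ eqToHom (one_smul G y).symm
  homMap_mul : ∀ (s t : G) {x y : C} (f : x ⟶ y),
    homMap (s * t) f =
      eqToHom (mul_smul s t x) ≫ homMap s (homMap t f) ≫ eqToHom (mul_smul s t y).symm

variable (C : Type u) [SmallCategory C] [Preadditive C] [Linear k C] [MulAction G C]
  [LinearAction k G C]

variable {G C} in
theorem LinearAction.homMap_eqToHom (s : G) {x y : C} (h : x = y) :
    LinearAction.homMap (k := k) s (eqToHom h) = eqToHom (congrArg (s • ·) h) := by
  subst h
  simp [LinearAction.homMap_id]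

/-- The action of `G` on chains, `s • (f n ⊗ ⋯ ⊗ f 0) = s • f n ⊗ ⋯ ⊗ s • f 0`. -/
noncomputable def chainRep (n : ℕ) : Representation k G (Chain k C n) where
  toFun s := mapChain (fun x => s • x) (fun _ _ => LinearAction.homMap s) n
  map_one' := by
    refine chain_hom_ext fun x f => ?_
    rw [mapChain_tens]
    refine tens_congr k (funext fun i => one_smul G (x i)) _ _ fun i => ?_
    exact LinearAction.homMap_one (f i)
  map_mul' s t := by
    refine chain_hom_ext fun x f => ?_
    rw [Module.End.mul_apply, mapChain_tens, mapChain_tens, mapChain_tens]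
    refine tens_congr k (funext fun i => mul_smul s t (x i)) _ _ fun i => ?_
    exact LinearAction.homMap_mul s t (f i)

/-- The Hochschild-Mitchell complex of a `k`-linear category with an action of `G`, as a complex of
`kG`-modules. -/
noncomputable def chainComplex : ChainComplex (Rep.{u} k G) ℕ :=
  ChainComplex.of (fun n => Rep.of (chainRep k G C n))
    (fun n => Rep.ofHom
      { toLinearMap := boundary k n
        isIntertwining' := fun s => LinearMap.ext fun c =>
          (mapChain_boundary (fun x : C => s • x) (fun _ _ => LinearAction.homMap s)
            (LinearAction.homMap_comp s) n c).symm })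
    (fun n => Rep.hom_ext (Representation.IntertwiningMap.ext
      (LinearMap.ext fun c => boundary_boundary k n c)))

/-- The Hochschild-Mitchell homology of a `k`-linear category with an action of `G`, as
`kG`-modules. -/
noncomputable def homology (n : ℕ) : Rep.{u} k G := (chainComplex k G C).homology n

/-- The complex of coinvariants of the Hochschild-Mitchell complex. -/
noncomputable def coinvariantsComplex : ChainComplex (ModuleCat.{u} k) ℕ :=
  ((Rep.coinvariantsFunctor k G).mapHomologicalComplex _).obj (chainComplex k G C)

variable {C} in
/-- The class of an elementary chain in the coinvariants. -/
noncomputable def coinvariantsTens {n : ℕ} {x : Fin (n + 1) → C} (f : ∀ i, x i ⟶ x (i + 1)) :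
    (coinvariantsComplex k G C).X n :=
  Representation.Coinvariants.mk (chainRep k G C n) (tens k f)

/-- The coinvariants functor from `kG`-modules to `k`-modules is exact: it preserves short exact
sequences. -/
def CoinvariantsExact : Prop :=
  ∀ S : ShortComplex (Rep.{u} k G), S.ShortExact → (S.map (Rep.coinvariantsFunctor k G)).ShortExact

/-- `T` contains exactly one element of each orbit. -/
def IsTransversal {E : Type u} [MulAction G E] (T : Set E) : Prop :=
  ∀ x : E, ∃! u : E, u ∈ T ∧ u ∈ MulAction.orbit G x

end Action

section Skew

/-- The skew category `C[G]`, which has the same objects as `C`. -/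
structure SkewCategory (k G C : Type u) where
  /-- The underlying object of `C`. -/
  obj : C

variable (k : Type u) [CommRing k] (G : Type u) [Group G]
  {C : Type u} [SmallCategory C] [Preadditive C] [Linear k C] [MulAction G C]

namespace SkewCategory

/-- The morphisms of the skew category: the direct sum over `s` of the morphisms
`s • x ⟶ y` of `C`. -/
abbrev Hom (x y : SkewCategory k G C) : Type u := ⨁ s : G, (s • x.obj ⟶ y.obj)

variable {k G}

open Classical in
/-- The homogeneous morphism of degree `s` of the skew category given by `f : s • x ⟶ y`. -/
noncomputable def single {x y : SkewCategory k G C} (s : G) (f : s • x.obj ⟶ y.obj) :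
    Hom k G x y :=
  DirectSum.lof k G (fun s => (s • x.obj ⟶ y.obj)) s f

theorem single_congr {x y : SkewCategory k G C} {s t : G} (h : s = t) (f : s • x.obj ⟶ y.obj)
    (g : t • x.obj ⟶ y.obj) (hf : f = eqToHom (congrArg (· • x.obj) h) ≫ g) :
    single s f = single t g := by
  subst h
  simp [hf]

theorem hom_induction {x y : SkewCategory k G C} {P : Hom k G x y → Prop} (f : Hom k G x y)
    (zero : P 0) (add : ∀ a b, P a → P b → P (a + b)) (single : ∀ s f, P (single s f)) : P f := by
  classical
  exact DirectSum.induction_on f zero single add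

variable [LinearAction k G C]

open Classical in
/-- Composition in the skew category: `g ∘ f = g ∘ (t • f)`, of degree `t * s`, for `f` of degree
`s` and `g` of degree `t`. -/
noncomputable def compHom (x y z : SkewCategory k G C) :
    Hom k G x y →ₗ[k] Hom k G y z →ₗ[k] Hom k G x z :=
  DirectSum.toModule k G _ fun s => LinearMap.flip <| DirectSum.toModule k G _ fun t =>
    LinearMap.mk₂ k
      (fun (g : t • y.obj ⟶ z.obj) (f : s • x.obj ⟶ y.obj) =>
        single (t * s) (eqToHom (mul_smul t s x.obj) ≫ LinearAction.homMap (k := k) t f ≫ g))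
      (fun g g' f => by simp [single])
      (fun c g f => by simp [single])
      (fun g f f' => by simp [single])
      (fun c g f => by simp [single])

@[simp]
theorem compHom_single {x y z : SkewCategory k G C} (s t : G) (f : s • x.obj ⟶ y.obj)
    (g : t • y.obj ⟶ z.obj) :
    compHom x y z (single s f) (single t g) =
      single (t * s) (eqToHom (mul_smul t s x.obj) ≫ LinearAction.homMap (k := k) t f ≫ g) := by
  simp [compHom, single]

noncomputable instance : SmallCategory (SkewCategory k G C) where
  Hom x y := Hom k G x y
  id x := single 1 (eqToHom (one_smul G x.obj))
  comp f g := compHom _ _ _ f g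
  id_comp {x y} f := by
    induction f using hom_induction with
    | zero => simp
    | add a b ha hb => rw [map_add, ha, hb]
    | single s f =>
      rw [compHom_single]
      exact single_congr (mul_one s) _ _ (by simp [LinearAction.homMap_eqToHom])
  comp_id {x y} f := by
    induction f using hom_induction with
    | zero => simp
    | add a b ha hb => rw [map_add, LinearMap.add_apply, ha, hb]
    | single s f =>
      rw [compHom_single]
      exact single_congr (one_mul s) _ _ (by simp [LinearAction.homMap_one])
  assoc {w x y z} f g h := by
    induction f using hom_induction with
    | zero => simp
    | add a b ha hb => simp only [map_add, LinearMap.add_apply, ha, hb]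
    | single s f =>
    induction g using hom_induction with
    | zero => simp
    | add a b ha hb => simp only [map_add, LinearMap.add_apply, ha, hb]
    | single t g =>
    induction h using hom_induction with
    | zero => simp
    | add a b ha hb => simp only [map_add, ha, hb]
    | single r h =>
      simp only [compHom_single]
      refine single_congr (mul_assoc r t s).symm _ _ ?_
      simp [LinearAction.homMap_mul, LinearAction.homMap_comp, LinearAction.homMap_eqToHom]

noncomputable instance : Preadditive (SkewCategory k G C) where
  homGroup x y := inferInstanceAs (AddCommGroup (Hom k G x y))
  add_comp x y z f f' g := LinearMap.map_add₂ (compHom x y z) f f' g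
  comp_add x y z f g g' := (compHom x y z f).map_add g g'

noncomputable instance : Linear k (SkewCategory k G C) where
  homModule x y := inferInstanceAs (Module k (Hom k G x y))
  smul_comp x y z c f g := LinearMap.map_smul₂ (compHom x y z) c f g
  comp_smul x y z f c g := (compHom x y z f).map_smul c g

variable (k G C) in
open Classical in
/-- The grading of the skew category. -/
noncomputable def grading : Grading k G (SkewCategory k G C) where
  part x y s := LinearMap.range (DirectSum.lof k G (fun s => (s • x.obj ⟶ y.obj)) s)
  isInternal x y := by
    let u : ∀ s : G, (s • x.obj ⟶ y.obj) ≃ₗ[k]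
        LinearMap.range (DirectSum.lof k G (fun s => (s • x.obj ⟶ y.obj)) s) := fun s =>
      LinearEquiv.ofInjective _ (DirectSum.of_injective s)
    let e := DirectSum.lmap fun s => (u s).toLinearMap
    have he : Function.Bijective e :=
      ⟨(DirectSum.lmap_injective _).2 fun s => (u s).injective,
        (DirectSum.lmap_surjective _).2 fun s => (u s).surjective⟩
    have h : (DirectSum.coeLinearMap fun s : G =>
        LinearMap.range (DirectSum.lof k G (fun s => (s • x.obj ⟶ y.obj)) s)).comp e =
          LinearMap.id := by
      refine DirectSum.linearMap_ext k fun s => LinearMap.ext fun f => ?_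
      simp only [LinearMap.comp_apply, e, u, DirectSum.lmap_lof, DirectSum.coeLinearMap_lof]
      rfl
    have h' : Function.Bijective ((DirectSum.coeLinearMap fun s : G =>
        LinearMap.range (DirectSum.lof k G (fun s => (s • x.obj ⟶ y.obj)) s)) ∘ e) := by
      have : ⇑(DirectSum.coeLinearMap fun s : G => LinearMap.range
          (DirectSum.lof k G (fun s => (s • x.obj ⟶ y.obj)) s)) ∘ e = id :=
        congrArg DFunLike.coe h
      rw [this]
      exact Function.bijective_id
    exact (Function.Bijective.of_comp_iff _ he).1 h'
  comp_mem := by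
    rintro x y z s t _ _ ⟨f, rfl⟩ ⟨g, rfl⟩
    exact ⟨_, (compHom_single s t f g).symm⟩

variable (k G) in
/-- The full subcategory `C_T[G]` of the skew category has the objects of `T`. -/
def onSet (T : Set C) : ObjectProperty (SkewCategory k G C) := fun X => X.obj ∈ T

/-- For `f : s • x ⟶ t • y` in `C`, the morphism `t⁻¹ • f : (t⁻¹ * s) • x ⟶ y` of `C`, seen as a
morphism of degree `t⁻¹ * s` from `x` to `y` in the skew category. -/
noncomputable def ofTranslate {x y : SkewCategory k G C} (s t : G)
    (f : s • x.obj ⟶ t • y.obj) : x ⟶ y :=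
  single (t⁻¹ * s) (eqToHom (mul_smul t⁻¹ s x.obj) ≫ LinearAction.homMap (k := k) t⁻¹ f ≫
    eqToHom (inv_smul_smul t y.obj))

end SkewCategory

variable [LinearAction k G C]

variable (C) in
/-- The complex of chains of class `{1}` of the skew category `C[G]`. -/
noncomputable abbrev skewComplex : ChainComplex (ModuleCat.{u} k) ℕ :=
  (SkewCategory.grading k G C).classComplex (ConjClasses.mk 1)

variable (C) in
/-- The summand of class `{1}` of the Hochschild-Mitchell homology of the skew category `C[G]`. -/
noncomputable abbrev skewHomology (n : ℕ) : ModuleCat.{u} k :=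
  (SkewCategory.grading k G C).classHomology (ConjClasses.mk 1) n

/-- The grading of the full subcategory `C_T[G]` of the skew category. -/
noncomputable abbrev transversalGrading (T : Set C) :
    Grading k G (SkewCategory.onSet k G T).FullSubcategory :=
  (SkewCategory.grading k G C).restrict (SkewCategory.onSet k G T)

/-- The complex of chains of class `{1}` of `C_T[G]`. -/
noncomputable abbrev transversalComplex (T : Set C) : ChainComplex (ModuleCat.{u} k) ℕ :=
  (transversalGrading k G T).classComplex (ConjClasses.mk 1)

/-- The map from the complex of chains of class `{1}` of `C_T[G]` to that of `C[G]` induced by the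
inclusion. -/
noncomputable abbrev transversalInclusion (T : Set C) :
    transversalComplex k G T ⟶ skewComplex k G C :=
  (SkewCategory.grading k G C).inclusion (ConjClasses.mk 1) (SkewCategory.onSet k G T)

end Skew

end HochschildMitchell

open HochschildMitchell

/-! By freeness every object of `C` is `σ x • ρ x` for a unique `ρ x ∈ T` and a unique `σ x : G`.
Sending `f : x ⟶ y` to its translate by `(σ y)⁻¹`, of degree `(σ y)⁻¹ * σ x`, is functorial, hence a
chain map from the chains of `C` to those of `C_T[G]`. Around a closed path the degrees telescope to
`1`, and translating the whole path by an element of `G` does not change its image, so the map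
descends to coinvariants with values in class `{1}`. Conversely, a cyclic sequence `p` with product
`1` has the form `p i = (t (i + 1))⁻¹ * t i`, with `t` unique up to left multiplication by one
element of `G`. So a closed homogeneous path of class `{1}` lifts to `C`, uniquely up to
translation, which gives bijectivity (`coinvariantsToChain_surjective`,
`coinvariantsToChain_injective`).

For the inclusion of `C_T[G]`, each object `x` of `C[G]` is isomorphic to `ρ x` by a homogeneous
isomorphism. Conjugation by these isomorphisms is a retraction onto `C_T[G]`, and prism operators
make it homotopic to the identity (`boundary_prismSum_succ`). Conjugation and inserted identities
change the product of the degrees at most by conjugation, so the homotopy stays within a class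
(`Grading.quasiIso_inclusion`).

The homology statements follow by choosing a transversal and composing the two comparisons; an exact
coinvariants functor moreover commutes with homology. -/

namespace HochschildMitchell

/-! ### Composites along closed paths, counted with length. -/

section Composites

variable {B : Type u} [SmallCategory B] {n m : ℕ}

/-- `Composite f ℓ a b g`: `g` is the composite of the `ℓ` consecutive morphisms of the closed
path `f` that start at `x a`, and it ends at `x b`. -/
inductive Composite {x : Fin (n + 1) → B} (f : ∀ i, x i ⟶ x (i + 1)) :
    ℕ → ∀ a b : Fin (n + 1), (x a ⟶ x b) → Prop
  | nil {a b : Fin (n + 1)} (h : a = b) : Composite f 0 a b (eqToHom (congrArg x h))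
  | cons {ℓ : ℕ} {a c b : Fin (n + 1)} (h : a + 1 = c) {g : x c ⟶ x b}
      (hg : Composite f ℓ c b g) : Composite f (ℓ + 1) a b (edge f h ≫ g)

variable {x : Fin (n + 1) → B} {f : ∀ i, x i ⟶ x (i + 1)}

/-- The length is what makes this true: from a vertex to itself both the empty composite and the
full loop are available. `Walk` has no empty walk and so cannot describe the identities inserted by
degeneracies. -/
theorem Composite.unique {ℓ : ℕ} {a b : Fin (n + 1)} {g g' : x a ⟶ x b}
    (h : Composite f ℓ a b g) (h' : Composite f ℓ a b g') : g = g' := by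
  induction h with
  | nil h => cases h'; rfl
  | cons h hg ih =>
    cases h' with
    | cons h' hg' => subst h; subst h'; rw [ih hg']

theorem Composite.one {a b : Fin (n + 1)} (h : a + 1 = b) : Composite f 1 a b (edge f h) := by
  simpa using Composite.cons (f := f) h (.nil rfl)

theorem Composite.trans {ℓ ℓ' : ℕ} {a c b : Fin (n + 1)} {g : x a ⟶ x c} {g' : x c ⟶ x b}
    (h : Composite f ℓ a c g) (h' : Composite f ℓ' c b g') :
    Composite f (ℓ + ℓ') a b (g ≫ g') := by
  induction h with
  | nil h => subst h; simpa using h'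
  | cons h hg ih =>
    rw [Category.assoc, Nat.add_right_comm]
    exact .cons h (ih h')

theorem Composite.edge {φ : Fin (m + 1) → Fin (n + 1)} {ℓ : Fin (m + 1) → ℕ}
    {g : ∀ i, x (φ i) ⟶ x (φ (i + 1))} (hg : ∀ i, Composite f (ℓ i) (φ i) (φ (i + 1)) (g i))
    {a b : Fin (m + 1)} (h : a + 1 = b) :
    Composite f (ℓ a) (φ a) (φ b) (HochschildMitchell.edge (x := fun i => x (φ i)) g h) := by
  subst h
  simpa [HochschildMitchell.edge] using hg a

/-- The lengths of the morphisms of `face v f` when `f i` has length `ℓ i`. -/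
def faceLength (v : Fin (m + 2)) (ℓ : Fin (m + 2) → ℕ) (i : Fin (m + 1)) : ℕ :=
  if v.succAbove i + 1 = v then ℓ (v.succAbove i) + ℓ v else ℓ (v.succAbove i)

theorem Composite.face {φ : Fin (m + 2) → Fin (n + 1)} {ℓ : Fin (m + 2) → ℕ}
    {g : ∀ i, x (φ i) ⟶ x (φ (i + 1))} (hg : ∀ i, Composite f (ℓ i) (φ i) (φ (i + 1)) (g i))
    (v : Fin (m + 2)) (i : Fin (m + 1)) :
    Composite f (faceLength v ℓ i) (φ (v.succAbove i)) (φ (v.succAbove (i + 1)))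
      (HochschildMitchell.face (x := fun i => x (φ i)) v g i) := by
  unfold HochschildMitchell.face faceLength
  split_ifs with h
  · exact (Composite.edge hg h).trans (Composite.edge hg _)
  · exact Composite.edge hg _

theorem val_add_one_eq (a : Fin (n + 1)) :
    (a + 1).val = if a.val = n then 0 else a.val + 1 := by
  rw [Fin.val_add_one]
  simp [Fin.ext_iff]

theorem val_succAbove_eq (v : Fin (n + 1)) (i : Fin n) :
    (v.succAbove i).val = if i.val < v.val then i.val else i.val + 1 := by
  simp only [Fin.succAbove, Fin.lt_def, Fin.val_castSucc]
  split_ifs <;> simp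

theorem val_predAbove_eq (j : Fin n) (a : Fin (n + 1)) :
    (j.predAbove a).val = if j.val < a.val then a.val - 1 else a.val := by
  simp only [Fin.predAbove, Fin.lt_def, Fin.val_castSucc]
  split_ifs <;> simp

theorem predAbove_add_one_of_eq {j : Fin (n + 1)} {a : Fin (n + 2)} (h : a = j.castSucc) :
    j.predAbove a = j.predAbove (a + 1) := by
  subst h
  simp

theorem predAbove_add_one_of_ne {j : Fin (n + 1)} {a : Fin (n + 2)} (h : a ≠ j.castSucc) :
    j.predAbove a + 1 = j.predAbove (a + 1) := by
  have := a.2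
  rw [Ne, Fin.ext_iff, Fin.val_castSucc] at h
  simp only [Fin.ext_iff, val_add_one_eq, val_predAbove_eq]
  grind

/-- The closed path obtained by repeating the vertex `x j`: an identity is inserted at `x j`. -/
noncomputable def degen (j : Fin (n + 1)) {x : Fin (n + 1) → B} (f : ∀ i, x i ⟶ x (i + 1))
    (a : Fin (n + 2)) : x (j.predAbove a) ⟶ x (j.predAbove (a + 1)) :=
  if h : a = j.castSucc then eqToHom (congrArg x (predAbove_add_one_of_eq h))
  else edge f (predAbove_add_one_of_ne h)

/-- The lengths of the morphisms of `degen j f` when `f i` has length `ℓ i`. -/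
def degenLength (j : Fin (m + 1)) (ℓ : Fin (m + 1) → ℕ) (a : Fin (m + 2)) : ℕ :=
  if a = j.castSucc then 0 else ℓ (j.predAbove a)

theorem Composite.degen {φ : Fin (m + 1) → Fin (n + 1)} {ℓ : Fin (m + 1) → ℕ}
    {g : ∀ i, x (φ i) ⟶ x (φ (i + 1))} (hg : ∀ i, Composite f (ℓ i) (φ i) (φ (i + 1)) (g i))
    (j : Fin (m + 1)) (a : Fin (m + 2)) :
    Composite f (degenLength j ℓ a) (φ (j.predAbove a)) (φ (j.predAbove (a + 1)))
      (HochschildMitchell.degen (x := fun i => x (φ i)) j g a) := by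
  unfold HochschildMitchell.degen degenLength
  split_ifs with h
  · exact .nil (congrArg φ (predAbove_add_one_of_eq h))
  · exact Composite.edge hg _

theorem Composite.self (f : ∀ i, x i ⟶ x (i + 1)) (i : Fin (n + 1)) :
    Composite f 1 i (i + 1) (f i) := by
  simpa [HochschildMitchell.edge] using Composite.one (f := f) (a := i) rfl

end Composites

/-! ### Degeneracies and the simplicial identities. -/

section Degeneracies

variable (k : Type u) [CommRing k] {B : Type u} [SmallCategory B] [Preadditive B] [Linear k B]
  {n m : ℕ}

/-- Reduces a simplicial identity to two arithmetic facts: both sides visit the same vertices, and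
their morphisms have the same lengths as composites of the original path. -/
theorem tens_eq_of_composite {x : Fin (m + 1) → B} {f : ∀ i, x i ⟶ x (i + 1)}
    {φ φ' : Fin (n + 1) → Fin (m + 1)} {ℓ ℓ' : Fin (n + 1) → ℕ} (hφ : φ = φ') (hℓ : ℓ = ℓ')
    {g : ∀ i, x (φ i) ⟶ x (φ (i + 1))} {g' : ∀ i, x (φ' i) ⟶ x (φ' (i + 1))}
    (hg : ∀ i, Composite f (ℓ i) _ _ (g i)) (hg' : ∀ i, Composite f (ℓ' i) _ _ (g' i)) :
    tens k (x := fun i => x (φ i)) g = tens k (x := fun i => x (φ' i)) g' := by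
  subst hφ hℓ
  congr 1
  funext i
  exact (hg i).unique (hg' i)

open Classical in
/-- The elementary chains as a multilinear map. -/
noncomputable def tensMultilinear (x : Fin (n + 1) → B) :
    MultilinearMap k (fun i => (x i ⟶ x (i + 1))) (Chain k B n) :=
  (DirectSum.lof k (Fin (n + 1) → B)
    (fun x => ⨂[k] i : Fin (n + 1), (x i ⟶ x (i + 1))) x).compMultilinearMap
      (PiTensorProduct.tprod k)

@[simp]
theorem tensMultilinear_apply (x : Fin (n + 1) → B) (f : ∀ i, x i ⟶ x (i + 1)) :
    tensMultilinear k x f = tens k f := rfl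

theorem degen_update [DecidableEq (Fin (n + 1))] (j : Fin (n + 1)) {x : Fin (n + 1) → B}
    (f : ∀ i, x i ⟶ x (i + 1)) (i : Fin (n + 1)) :
    ∃ (a : Fin (n + 2))
      (l : (x i ⟶ x (i + 1)) →ₗ[k] (x (j.predAbove a) ⟶ x (j.predAbove (a + 1)))),
      ∀ c, degen j (Function.update f i c) = Function.update (degen j f) a (l c) := by
  -- The position `j.castSucc.succAbove i` is the only one where `f i` occurs in the degenerate
  -- path; position `j.castSucc` carries the inserted identity.
  obtain ⟨a, ha, rfl⟩ : ∃ a, a ≠ j.castSucc ∧ j.predAbove a = i :=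
    ⟨_, Fin.succAbove_ne _ _, Fin.predAbove_succAbove j i⟩
  refine ⟨a, Linear.rightComp k _ (eqToHom (congrArg x (predAbove_add_one_of_ne ha))),
    fun c => ?_⟩
  funext b
  rcases eq_or_ne b a with rfl | hb
  · simp [degen, ha, edge]
  · by_cases hj : b = j.castSucc
    · simp [degen, hj, ha.symm]
    · have : j.predAbove b ≠ j.predAbove a := fun e => hb <| by
        have h1 := Fin.succAbove_predAbove hj
        have h2 := Fin.succAbove_predAbove ha
        rw [← h1, ← h2, e]
      simp [degen, hj, edge, hb, this]

/-- The `j`-th degeneracy map on chains. -/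
noncomputable def degenMap (j : Fin (n + 1)) : Chain k B n →ₗ[k] Chain k B (n + 1) :=
  liftChain k fun x =>
    { toFun := fun f => tens k (x := fun a => x (j.predAbove a)) (degen j f)
      map_update_add' := fun f i a b => by
        classical
        obtain ⟨a₀, l, h⟩ := degen_update k j f i
        simp only [h, map_add, tens, MultilinearMap.map_update_add]
      map_update_smul' := fun f i c a => by
        classical
        obtain ⟨a₀, l, h⟩ := degen_update k j f i
        simp only [h, map_smul, tens, MultilinearMap.map_update_smul] }

@[simp]
theorem degenMap_tens (j : Fin (n + 1)) {x : Fin (n + 1) → B} (f : ∀ i, x i ⟶ x (i + 1)) :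
    degenMap k j (tens k f) = tens k (x := fun a => x (j.predAbove a)) (degen j f) := by
  simp [degenMap]

/-- Deleting the first copy of the doubled vertex composes the inserted identity with its
predecessor. The next lemma deletes the second copy and absorbs the identity into its successor. -/
theorem faceMap_degenMap_castSucc (j : Fin (n + 1)) (c : Chain k B n) :
    faceMap k j.castSucc (degenMap k j c) = c := by
  suffices (faceMap k j.castSucc).comp (degenMap (B := B) k j) = LinearMap.id from
    LinearMap.congr_fun this c
  refine chain_hom_ext fun x f => ?_
  simp only [LinearMap.comp_apply, degenMap_tens, faceMap_tens, LinearMap.id_apply]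
  refine tens_eq_of_composite k (x := x) (f := f)
    (φ := fun i => j.predAbove (j.castSucc.succAbove i)) (φ' := id) ?_ ?_
    (Composite.face (Composite.degen (φ := id) (Composite.self f) j) j.castSucc)
    (Composite.self f)
  · funext a
    have := a.2
    simp only [Fin.ext_iff, val_succAbove_eq, val_predAbove_eq, Fin.val_castSucc, id] at *
    grind
  · funext a
    have := a.2
    simp only [faceLength, degenLength, Fin.ext_iff, val_add_one_eq, val_succAbove_eq,
      Fin.val_castSucc] at *
    grind

theorem faceMap_degenMap_succ (j : Fin (n + 1)) (c : Chain k B n) :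
    faceMap k j.succ (degenMap k j c) = c := by
  suffices (faceMap k j.succ).comp (degenMap (B := B) k j) = LinearMap.id from
    LinearMap.congr_fun this c
  refine chain_hom_ext fun x f => ?_
  simp only [LinearMap.comp_apply, degenMap_tens, faceMap_tens, LinearMap.id_apply]
  refine tens_eq_of_composite k (x := x) (f := f)
    (φ := fun i => j.predAbove (j.succ.succAbove i)) (φ' := id) ?_ ?_
    (Composite.face (Composite.degen (φ := id) (Composite.self f) j) j.succ)
    (Composite.self f)
  · funext a
    have := a.2
    simp only [Fin.ext_iff, val_succAbove_eq, val_predAbove_eq, Fin.val_succ, id] at *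
    grind
  · funext a
    have := a.2
    simp only [faceLength, degenLength, Fin.ext_iff, val_add_one_eq, val_succAbove_eq,
      Fin.val_castSucc, Fin.val_succ] at *
    grind

theorem faceMap_degenMap_of_le {i : Fin (n + 2)} {j : Fin (n + 1)} (h : i ≤ j.castSucc)
    (c : Chain k B (n + 1)) :
    faceMap k i.castSucc (degenMap k j.succ c) = degenMap k j (faceMap k i c) := by
  suffices (faceMap k i.castSucc).comp (degenMap (B := B) k j.succ) =
    (degenMap k j).comp (faceMap k i) from LinearMap.congr_fun this c
  refine chain_hom_ext fun x f => ?_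
  simp only [LinearMap.comp_apply, degenMap_tens, faceMap_tens]
  refine tens_eq_of_composite k (x := x) (f := f)
    (φ := fun a => j.succ.predAbove (i.castSucc.succAbove a))
    (φ' := fun a => i.succAbove (j.predAbove a)) ?_ ?_
    (Composite.face (Composite.degen (φ := id) (Composite.self f) j.succ) i.castSucc)
    (Composite.degen (Composite.face (φ := id) (Composite.self f) i) j)
  · funext a
    have := a.2
    simp only [Fin.le_def, Fin.ext_iff, val_succAbove_eq, val_predAbove_eq,
      Fin.val_castSucc, Fin.val_succ] at *
    grind
  · funext a
    have := a.2
    simp only [faceLength, degenLength, Fin.le_def, Fin.ext_iff, val_add_one_eq, val_succAbove_eq,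
      val_predAbove_eq,
      Fin.val_castSucc, Fin.val_succ] at *
    grind

theorem faceMap_degenMap_of_lt {i : Fin (n + 2)} {j : Fin (n + 1)} (h : j.castSucc < i)
    (c : Chain k B (n + 1)) :
    faceMap k i.succ (degenMap k j.castSucc c) = degenMap k j (faceMap k i c) := by
  suffices (faceMap k i.succ).comp (degenMap (B := B) k j.castSucc) =
    (degenMap k j).comp (faceMap k i) from LinearMap.congr_fun this c
  refine chain_hom_ext fun x f => ?_
  simp only [LinearMap.comp_apply, degenMap_tens, faceMap_tens]
  refine tens_eq_of_composite k (x := x) (f := f)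
    (φ := fun a => j.castSucc.predAbove (i.succ.succAbove a))
    (φ' := fun a => i.succAbove (j.predAbove a)) ?_ ?_
    (Composite.face (Composite.degen (φ := id) (Composite.self f) j.castSucc) i.succ)
    (Composite.degen (Composite.face (φ := id) (Composite.self f) i) j)
  · funext a
    have := a.2
    simp only [Fin.lt_def, Fin.ext_iff, val_succAbove_eq, val_predAbove_eq,
      Fin.val_castSucc, Fin.val_succ] at *
    grind
  · funext a
    have := a.2
    simp only [faceLength, degenLength, Fin.lt_def, Fin.ext_iff, val_add_one_eq, val_succAbove_eq,
      val_predAbove_eq,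
      Fin.val_castSucc, Fin.val_succ] at *
    grind

end Degeneracies

end HochschildMitchell

namespace HochschildMitchell

/-! ### Replacing vertices by isomorphic objects. -/

section Twist

variable (k : Type u) [CommRing k] {B : Type u} [SmallCategory B] [Preadditive B] [Linear k B]
  {n : ℕ} {I : Type} {o : I → B → B} (θ : ∀ i x, x ≅ o i x)

/-- Conjugation of morphisms by the isomorphisms `θ i x` and `θ j y`. -/
def conjHom (i j : I) (x y : B) : (x ⟶ y) →ₗ[k] (o i x ⟶ o j y) :=
  (Linear.leftComp k _ (θ i x).inv).comp (Linear.rightComp k _ (θ j y).hom)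

@[simp]
theorem conjHom_apply (i j : I) {x y : B} (f : x ⟶ y) :
    conjHom k θ i j x y f = (θ i x).inv ≫ f ≫ (θ j y).hom := rfl

/-- The map on chains that replaces the vertex `x i` by the isomorphic object `o (ε i) (x i)`. -/
noncomputable def twist (ε : Fin (n + 1) → I) : Chain k B n →ₗ[k] Chain k B n :=
  liftChain k fun x => (tensMultilinear k fun i => o (ε i) (x i)).compLinearMap
    fun i => conjHom k θ (ε i) (ε (i + 1)) (x i) (x (i + 1))

@[simp]
theorem twist_tens (ε : Fin (n + 1) → I) {x : Fin (n + 1) → B} (f : ∀ i, x i ⟶ x (i + 1)) :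
    twist k θ ε (tens k f) = tens k (x := fun i => o (ε i) (x i))
      fun i => conjHom k θ (ε i) (ε (i + 1)) (x i) (x (i + 1)) (f i) := by
  simp [twist]

theorem conjHom_edge (ε : Fin (n + 1) → I) {x : Fin (n + 1) → B} (f : ∀ i, x i ⟶ x (i + 1))
    {a b : Fin (n + 1)} (h : a + 1 = b) :
    conjHom k θ (ε a) (ε b) (x a) (x b) (edge f h) =
      edge (x := fun i => o (ε i) (x i))
        (fun i => conjHom k θ (ε i) (ε (i + 1)) (x i) (x (i + 1)) (f i)) h := by
  subst h
  simp [edge]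

/-- At the deleted vertex the two conjugations contribute an isomorphism followed by its inverse,
which cancel in the composite. -/
theorem faceMap_twist (ε : Fin (n + 2) → I) (v : Fin (n + 2)) (c : Chain k B (n + 1)) :
    faceMap k v (twist k θ ε c) = twist k θ (fun i => ε (v.succAbove i)) (faceMap k v c) := by
  suffices (faceMap k v).comp (twist k θ ε) =
      (twist k θ fun i => ε (v.succAbove i)).comp (faceMap k v) from LinearMap.congr_fun this c
  refine chain_hom_ext fun x f => ?_
  simp only [LinearMap.comp_apply, twist_tens, faceMap_tens]
  congr 1
  funext i
  unfold face
  split_ifs with h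
  · rw [← conjHom_edge, ← conjHom_edge]
    simp
  · rw [← conjHom_edge]

end Twist

/-! ### The prism homotopy between the identity and conjugation by `θ`. -/

section Homotopy

/-- The sum over the faces of the degenerate simplices, split according to the simplicial
identities. -/
theorem sum_faces_degeneracies {M : Type*} [AddCommGroup M] {n : ℕ}
    (F : Fin (n + 3) → Fin (n + 2) → M) :
    ∑ v, ∑ j, F v j = ∑ j : Fin (n + 2), (F j.castSucc j + F j.succ j) +
      ∑ i : Fin (n + 2), ∑ j : Fin (n + 1),
        if i ≤ j.castSucc then F i.castSucc j.succ else F i.succ j.castSucc := by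
  -- For fixed `i`, the indices `j.succ` with `i ≤ j.castSucc` are exactly those above `i`, and the
  -- `j.castSucc < i` exactly those below, so both cases become one sum over `Fin (n + 2)`.
  have h1 : ∀ i : Fin (n + 2), (∑ j : Fin (n + 1),
      if i ≤ j.castSucc then F i.castSucc j.succ else F i.succ j.castSucc) =
      ∑ j : Fin (n + 2), ((if i < j then F i.castSucc j else 0) +
        if j < i then F i.succ j else 0) := fun i => by
    rw [Finset.sum_add_distrib, Fin.sum_univ_succ fun j => if i < j then F i.castSucc j else 0,
      Fin.sum_univ_castSucc fun j => if j < i then F i.succ j else 0, if_neg (Fin.not_lt_zero i),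
      if_neg (Fin.le_last i).not_gt, zero_add, add_zero, ← Finset.sum_add_distrib]
    refine Finset.sum_congr rfl fun j _ => ?_
    by_cases h : i ≤ j.castSucc
    · have h' : ¬ j.castSucc < i := h.not_gt
      have h'' : i < j.succ := Fin.le_castSucc_iff.1 h
      simp [h, h', h'']
    · have h' : j.castSucc < i := not_le.1 h
      have h'' : ¬ i < j.succ := fun e => h (Fin.le_castSucc_iff.2 e)
      simp [h, h', h'']
  simp only [h1]
  rw [Finset.sum_comm, Finset.sum_comm (f := fun i j : Fin (n + 2) =>
    (if i < j then F i.castSucc j else 0) + if j < i then F i.succ j else 0),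
    ← Finset.sum_add_distrib]
  refine Finset.sum_congr rfl fun j _ => ?_
  -- The faces `j.castSucc` and `j.succ` are split off on the left; on the right the term `i = j` is
  -- split off and vanishes.
  rw [Fin.sum_univ_succAbove _ j.castSucc, Fin.sum_univ_succAbove _ j,
    Fin.sum_univ_succAbove _ j]
  simp only [lt_irrefl, if_false, add_zero, zero_add, Fin.succAbove_castSucc_self, add_assoc]
  refine congrArg _ (congrArg _ (Finset.sum_congr rfl fun a _ => ?_))
  rcases lt_or_gt_of_ne (Fin.succAbove_ne j a) with h | h
  · simp [h, h.not_gt, Fin.succAbove_of_castSucc_lt _ _ (Fin.castSucc_lt_castSucc_iff.2 h)]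
  · rw [if_neg h.not_gt, if_pos h, zero_add, Fin.succAbove_of_le_castSucc]
    exact Fin.castSucc_le_castSucc_iff.2 h.le

variable (k : Type u) [CommRing k] {B : Type u} [SmallCategory B] [Preadditive B] [Linear k B]
  {r : B → B} (θ : ∀ x, x ≅ r x)

/-- The isomorphisms `𝟙 x` and `θ x` as a family indexed by the Booleans. -/
def boolIso : ∀ (b : Bool) (x : B), x ≅ (bif b then r x else x)
  | false, x => Iso.refl x
  | true, x => θ x

/-- The twist of chains by `θ` at the vertices from the `t`-th on. -/
noncomputable def twistFrom (n t : ℕ) : Chain k B n →ₗ[k] Chain k B n :=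
  twist k (boolIso θ) fun a => decide (t ≤ a.val)

/-- The term `x 0 ⟶ ⋯ ⟶ x j ⟶ r (x j) ⟶ ⋯ ⟶ r (x n) ⟶ x 0` of the homotopy between the identity and
the map on chains induced by `r`. -/
noncomputable def prism (n : ℕ) (j : Fin (n + 1)) : Chain k B n →ₗ[k] Chain k B (n + 1) :=
  (twistFrom k θ (n + 1) (j + 1)).comp (degenMap k j)

/-- The homotopy between the identity and the map on chains induced by `r`. -/
noncomputable def prismSum (n : ℕ) : Chain k B n →ₗ[k] Chain k B (n + 1) :=
  ∑ j : Fin (n + 1), (-1 : k) ^ (j.rev : ℕ) • prism k θ n j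

variable {n : ℕ}

/-- The hypothesis says that the threshold `t` becomes `t'` after the vertices are renumbered
without `v`. -/
theorem faceMap_twistFrom {t t' : ℕ} (v : Fin (n + 2))
    (h : ∀ a : Fin (n + 1), t ≤ (v.succAbove a).val ↔ t' ≤ a.val) (c : Chain k B (n + 1)) :
    faceMap k v (twistFrom k θ (n + 1) t c) = twistFrom k θ n t' (faceMap k v c) := by
  simp only [twistFrom, faceMap_twist, h]

/-- In the `j`-th prism the doubled vertex occurs untwisted at `j` and twisted at `j + 1`. Deleting
the untwisted copy leaves a path twisted from `j`; deleting the twisted one leaves a path twisted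
from `j + 1`. -/
theorem faceMap_prism_castSucc (j : Fin (n + 1)) (c : Chain k B n) :
    faceMap k j.castSucc (prism k θ n j c) = twistFrom k θ n j c := by
  rw [prism, LinearMap.comp_apply, faceMap_twistFrom k θ (t' := j), faceMap_degenMap_castSucc]
  intro a
  simp only [val_succAbove_eq, Fin.val_castSucc]
  grind

theorem faceMap_prism_succ (j : Fin (n + 1)) (c : Chain k B n) :
    faceMap k j.succ (prism k θ n j c) = twistFrom k θ n (j + 1) c := by
  rw [prism, LinearMap.comp_apply, faceMap_twistFrom k θ (t' := j + 1), faceMap_degenMap_succ]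
  intro a
  simp only [val_succAbove_eq, Fin.val_succ]
  grind

theorem faceMap_prism_of_le {i : Fin (n + 2)} {j : Fin (n + 1)} (h : i ≤ j.castSucc)
    (c : Chain k B (n + 1)) :
    faceMap k i.castSucc (prism k θ (n + 1) j.succ c) = prism k θ n j (faceMap k i c) := by
  rw [prism, LinearMap.comp_apply, faceMap_twistFrom k θ (t' := j + 1), faceMap_degenMap_of_le k h]
  · rfl
  intro a
  simp only [Fin.le_def, val_succAbove_eq, Fin.val_succ, Fin.val_castSucc] at *
  grind

theorem faceMap_prism_of_lt {i : Fin (n + 2)} {j : Fin (n + 1)} (h : j.castSucc < i)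
    (c : Chain k B (n + 1)) :
    faceMap k i.succ (prism k θ (n + 1) j.castSucc c) = prism k θ n j (faceMap k i c) := by
  rw [prism, LinearMap.comp_apply, faceMap_twistFrom k θ (t' := j + 1), faceMap_degenMap_of_lt k h]
  · rfl
  intro a
  simp only [Fin.lt_def, val_succAbove_eq, Fin.val_succ, Fin.val_castSucc] at *
  grind

theorem boundary_prismSum (n : ℕ) (c : Chain k B n) :
    boundary k n (prismSum k θ n c) = ∑ v : Fin (n + 2), ∑ j : Fin (n + 1),
      ((-1 : k) ^ (v.rev + j.rev : ℕ)) • faceMap k v (prism k θ n j c) := by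
  simp only [boundary, prismSum, LinearMap.sum_apply, LinearMap.smul_apply, map_sum, map_smul,
    smul_smul, Finset.smul_sum, pow_add]
  exact Finset.sum_comm.trans (by simp only [mul_comm])

/-- The two diagonal faces of a prism carry opposite signs, and neighbouring prisms share a face, so
the sum telescopes. -/
theorem sum_diagonal_prism (n : ℕ) (c : Chain k B n) :
    ∑ j : Fin (n + 1),
      (((-1 : k) ^ (j.castSucc.rev + j.rev : ℕ)) • faceMap k j.castSucc (prism k θ n j c) +
        ((-1 : k) ^ (j.succ.rev + j.rev : ℕ)) • faceMap k j.succ (prism k θ n j c)) =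
      twistFrom k θ n (n + 1) c - twistFrom k θ n 0 c := by
  rw [← Finset.sum_range_sub (fun t => twistFrom k θ n t c), ← Fin.sum_univ_eq_sum_range
    (fun t => twistFrom k θ n (t + 1) c - twistFrom k θ n t c)]
  refine Finset.sum_congr rfl fun j _ => ?_
  rw [faceMap_prism_castSucc, faceMap_prism_succ, Odd.neg_one_pow, Even.neg_one_pow]
  · exact (congrArg₂ (· + ·) (neg_one_smul k _) (one_smul k _)).trans (neg_add_eq_sub _ _)
  · rw [Nat.even_iff]
    simp only [Fin.val_rev, Fin.val_succ]
    omega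
  · rw [Nat.odd_iff]
    simp only [Fin.val_rev, Fin.val_castSucc]
    omega

theorem boundary_prismSum_zero (c : Chain k B 0) :
    boundary k 0 (prismSum k θ 0 c) = twistFrom k θ 0 1 c - twistFrom k θ 0 0 c := by
  rw [boundary_prismSum, ← sum_diagonal_prism]
  simp [Fin.sum_univ_two]

theorem boundary_prismSum_succ (n : ℕ) (c : Chain k B (n + 1)) :
    boundary k (n + 1) (prismSum k θ (n + 1) c) + prismSum k θ n (boundary k n c) =
      twistFrom k θ (n + 1) (n + 2) c - twistFrom k θ (n + 1) 0 c := by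
  -- Once the diagonal faces are accounted for, the remaining ones must cancel against the prisms of
  -- the boundary, term by term in `(i, j)`.
  rw [boundary_prismSum, sum_faces_degeneracies, sum_diagonal_prism, add_assoc, add_eq_left]
  simp only [boundary, prismSum, LinearMap.sum_apply, LinearMap.smul_apply, map_sum, map_smul,
    smul_smul, Finset.smul_sum]
  rw [← Finset.sum_add_distrib]
  refine Finset.sum_eq_zero fun i _ => ?_
  rw [← Finset.sum_add_distrib]
  refine Finset.sum_eq_zero fun j _ => ?_
  rw [← pow_add]
  -- In either case one of the two reversed indices grows by one and the other is unchanged, so the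
  -- signs are opposite.
  split_ifs with h
  · rw [faceMap_prism_of_le k θ h, ← add_smul]
    convert zero_smul k _
    rw [add_eq_zero_iff_eq_neg, ← neg_one_mul (_ ^ _), ← pow_succ']
    refine neg_one_pow_congr ?_
    simp only [Fin.val_rev, Nat.even_iff, Fin.val_castSucc, Fin.val_succ]
    omega
  · rw [faceMap_prism_of_lt k θ (not_le.1 h), ← add_smul]
    convert zero_smul k _
    rw [add_eq_zero_iff_eq_neg, ← neg_one_mul (_ ^ _), ← pow_succ']
    refine neg_one_pow_congr ?_
    simp only [Fin.val_rev, Nat.even_iff, Fin.val_castSucc, Fin.val_succ]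
    omega

theorem twistFrom_of_lt {t : ℕ} (h : n < t) (c : Chain k B n) : twistFrom k θ n t c = c := by
  suffices twistFrom k θ n t = LinearMap.id from LinearMap.congr_fun this c
  refine chain_hom_ext fun x f => ?_
  have : (fun a : Fin (n + 1) => decide (t ≤ a.val)) = fun _ => false := by
    funext a
    simp
    omega
  rw [twistFrom, this, twist_tens, LinearMap.id_apply]
  congr 1
  funext i
  simp [boolIso]

theorem twistFrom_zero : twistFrom k θ n 0 =
    mapChain r (fun x y => conjHom k (fun _ => θ) () () x y) n := by
  refine chain_hom_ext fun x f => ?_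
  rw [mapChain_tens]
  simp only [twistFrom, zero_le, decide_true, twist_tens]
  rfl

end Homotopy

end HochschildMitchell

namespace HochschildMitchell

/-! ### Degrees under conjugation and degeneracy. -/

section RevProd

variable {G : Type u} [Group G]

theorem revProd_conj_castSucc {n : ℕ} (c : Fin (n + 1) → G) (s : Fin n → G) :
    revProd (fun i => c i.succ * s i * (c i.castSucc)⁻¹) =
      c (Fin.last n) * revProd s * (c 0)⁻¹ := by
  induction n with
  | zero => simp [revProd]
  | succ n ih =>
    rw [revProd_succ', revProd_succ' s]
    have := ih (fun i => c i.castSucc) (fun i => s i.castSucc)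
    simp only [Fin.succ_castSucc, Fin.castSucc_zero] at this ⊢
    rw [this]
    simp [mul_assoc]

/-- The inner factors telescope, and since the indices are cyclic the outer ones are `c 0` and its
inverse. Hence only the conjugacy class of the product survives changing the vertices. -/
theorem revProd_conj {n : ℕ} (c s : Fin (n + 1) → G) :
    revProd (fun i => c (i + 1) * s i * (c i)⁻¹) = c 0 * revProd s * (c 0)⁻¹ := by
  have := revProd_conj_castSucc c fun i => s i.castSucc
  rw [revProd_succ', revProd_succ' s]
  simp only [Fin.last_add_one, Fin.coeSucc_eq_succ]
  rw [this]
  simp [mul_assoc]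

theorem conjClasses_revProd_conj {n : ℕ} (c s : Fin (n + 1) → G) :
    ConjClasses.mk (revProd fun i => c (i + 1) * s i * (c i)⁻¹) = ConjClasses.mk (revProd s) := by
  rw [revProd_conj, ConjClasses.mk_eq_mk_iff_isConj]
  exact (isConj_iff.2 ⟨c 0, rfl⟩).symm

/-- The degrees of the morphisms of `degen j f` when `f i` has degree `s i`. -/
def degenDeg {n : ℕ} (j : Fin (n + 1)) (s : Fin (n + 1) → G) (a : Fin (n + 2)) : G :=
  if a = j.castSucc then 1 else s (j.predAbove a)

/-- The face at `j.succ` undoes the degeneracy, and a face at a nonzero vertex preserves the product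
exactly, not only up to conjugation. -/
theorem revProd_degenDeg {n : ℕ} (j : Fin (n + 1)) (s : Fin (n + 1) → G) :
    revProd (degenDeg j s) = revProd s := by
  rw [← revProd_faceDeg_succ j (degenDeg j s)]
  congr 1
  funext i
  have h : j.succ ≠ j.castSucc := (Fin.castSucc_lt_succ (i := j)).ne'
  unfold faceDeg degenDeg
  by_cases hi : i = j
  · subst hi
    simp [h]
  · have h1 : j.succ.succAbove i ≠ j.castSucc := by
      have := Fin.succAbove_right_injective (p := j.succ) |>.ne hi
      simpa using this
    have h2 : j.succ.succAbove i + 1 ≠ j.succ := by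
      simpa only [← Fin.coeSucc_eq_succ, ne_eq, add_left_inj] using h1
    have h3 : j.predAbove (j.succ.succAbove i) = i := by
      simp only [Fin.ext_iff, val_succAbove_eq, val_predAbove_eq, Fin.val_succ] at *
      grind
    simp [h1, h2, h3]

end RevProd

namespace Grading

variable {k : Type u} [CommRing k] {G : Type u} [Group G]
  {B : Type u} [SmallCategory B] [Preadditive B] [Linear k B]
  (γ : Grading k G B) (D : ConjClasses G)

theorem tens_mem_classChain {n : ℕ} {x : Fin (n + 1) → B} {f : ∀ i, x i ⟶ x (i + 1)}
    {s : Fin (n + 1) → G} (hf : ∀ i, f i ∈ γ.part _ _ (s i))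
    (hs : ConjClasses.mk (revProd s) = D) : tens k f ∈ γ.classChain D n :=
  Submodule.subset_span ⟨x, s, f, hf, hs, rfl⟩

theorem map_mem_of_mem_classChain {n : ℕ} {M : Type*} [AddCommGroup M] [Module k M]
    (φ : Chain k B n →ₗ[k] M) (p : Submodule k M)
    (h : ∀ (x : Fin (n + 1) → B) (f : ∀ i, x i ⟶ x (i + 1)) (s : Fin (n + 1) → G),
      (∀ i, f i ∈ γ.part _ _ (s i)) → ConjClasses.mk (revProd s) = D → φ (tens k f) ∈ p)
    {c : Chain k B n} (hc : c ∈ γ.classChain D n) : φ c ∈ p := by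
  refine (Submodule.span_le (p := p.comap φ)).2 ?_ hc
  rintro _ ⟨x, s, f, hf, hs, rfl⟩
  exact h x f s hf hs

theorem eqToHom_mem (hid : ∀ x, 𝟙 x ∈ γ.part x x 1) {x y : B} (h : x = y) :
    eqToHom h ∈ γ.part x y 1 := by
  subst h
  exact hid x

/-- `Grading` does not include homogeneity of identities among its fields; it enters as `hid`. -/
theorem degenMap_mem (hid : ∀ x, 𝟙 x ∈ γ.part x x 1) {n : ℕ} (j : Fin (n + 1)) {c : Chain k B n}
    (hc : c ∈ γ.classChain D n) : degenMap k j c ∈ γ.classChain D (n + 1) := by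
  refine γ.map_mem_of_mem_classChain D _ _ (fun x f s hf hs => ?_) hc
  rw [degenMap_tens]
  refine γ.tens_mem_classChain D (s := degenDeg j s) (fun a => ?_)
    ((congrArg _ (revProd_degenDeg j s)).trans hs)
  unfold degen degenDeg
  split_ifs with h
  · exact γ.eqToHom_mem hid _
  · exact γ.edge_mem hf _

/-- Conjugation by isomorphisms of degrees `e` turns the degree `s i` into `e (i + 1) * s i * (e
i)⁻¹`, in abbreviated notation, so `conjClasses_revProd_conj` applies. -/
theorem twist_mem {I : Type} {o : I → B → B} (θ : ∀ i x, x ≅ o i x) (e : I → B → G)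
    (hom_mem : ∀ i x, (θ i x).hom ∈ γ.part _ _ (e i x))
    (inv_mem : ∀ i x, (θ i x).inv ∈ γ.part _ _ (e i x)⁻¹) {n : ℕ} (ε : Fin (n + 1) → I)
    {c : Chain k B n} (hc : c ∈ γ.classChain D n) : twist k θ ε c ∈ γ.classChain D n := by
  refine γ.map_mem_of_mem_classChain D _ _ (fun x f s hf hs => ?_) hc
  rw [twist_tens]
  exact γ.tens_mem_classChain D
    (fun i => γ.comp_mem (inv_mem _ _) (γ.comp_mem (hf i) (hom_mem _ _)))
    ((conjClasses_revProd_conj (fun i => e (ε i) (x i)) s).trans hs)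

end Grading

section Homotopy

/-- A homotopy between chain maps, from its components. -/
noncomputable def homotopyOfComponents {V : Type*} [Category* V] [Preadditive V]
    {P Q : ChainComplex V ℕ} {f g : P ⟶ Q} (h : ∀ n, P.X n ⟶ Q.X (n + 1))
    (h0 : f.f 0 = h 0 ≫ Q.d 1 0 + g.f 0)
    (hs : ∀ n, f.f (n + 1) =
      P.d (n + 1) n ≫ h n + h (n + 1) ≫ Q.d (n + 2) (n + 1) + g.f (n + 1)) :
    Homotopy f g where
  hom i j := if e : i + 1 = j then h i ≫ (Q.XIsoOfEq e).hom else 0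
  zero i j e := dif_neg e
  comm n := by
    cases n with
    | zero =>
      rw [Homotopy.dNext_zero_chainComplex, Homotopy.prevD_chainComplex, h0]
      simp
    | succ n =>
      rw [Homotopy.dNext_succ_chainComplex, Homotopy.prevD_chainComplex, hs]
      simp

end Homotopy

/-! ### Homogeneous retraction onto a full subcategory. -/

namespace Grading

variable {k : Type u} [CommRing k] {G : Type u} [Group G]
  {B : Type u} [SmallCategory B] [Preadditive B] [Linear k B]
  (γ : Grading k G B) (D : ConjClasses G) (P : ObjectProperty B)
  {r : B → B} (hr : ∀ x, P (r x)) (θ : ∀ x, x ≅ r x)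

/-- Conjugation by the isomorphisms `θ`, as a map to the full subcategory that contains their
targets. -/
def retractHom (x y : B) :
    (x ⟶ y) →ₗ[k] ((⟨r x, hr x⟩ : P.FullSubcategory) ⟶ ⟨r y, hr y⟩) where
  toFun f := ObjectProperty.homMk ((θ x).inv ≫ f ≫ (θ y).hom)
  map_add' f g := by
    ext
    simp
    rfl
  map_smul' c f := by
    ext
    simp
    rfl

/-- The map on chains to the full subcategory induced by `retractHom`. -/
noncomputable def retractChain (n : ℕ) : Chain k B n →ₗ[k] Chain k P.FullSubcategory n :=
  mapChain (fun x => ⟨r x, hr x⟩) (retractHom P hr θ) n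

theorem retractChain_boundary (n : ℕ) (c : Chain k B (n + 1)) :
    retractChain P hr θ n (boundary k n c) = boundary k n (retractChain P hr θ (n + 1) c) := by
  refine mapChain_boundary _ _ (fun f g => ?_) n c
  ext
  simp [retractHom]

variable {θ}

theorem retractChain_mem (e : B → G) (hom_mem : ∀ x, (θ x).hom ∈ γ.part _ _ (e x))
    (inv_mem : ∀ x, (θ x).inv ∈ γ.part _ _ (e x)⁻¹) {n : ℕ} {c : Chain k B n}
    (hc : c ∈ γ.classChain D n) :
    retractChain P hr θ n c ∈ (γ.restrict P).classChain D n := by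
  refine γ.map_mem_of_mem_classChain D _ _ (fun x f s hf hs => ?_) hc
  rw [retractChain, mapChain_tens]
  exact (γ.restrict P).tens_mem_classChain D
    (fun i => γ.comp_mem (inv_mem _) (γ.comp_mem (hf i) (hom_mem _)))
    ((conjClasses_revProd_conj (fun i => e (x i)) s).trans hs)

theorem mapChain_retractChain {n : ℕ} (c : Chain k B n) :
    mapChain P.ι.obj (fun _ _ => P.ι.mapLinearMap k) n (retractChain P hr θ n c) =
      twistFrom k θ n 0 c := by
  suffices (mapChain P.ι.obj (fun _ _ => P.ι.mapLinearMap k) n).comp (retractChain P hr θ n) =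
      twistFrom k θ n 0 from LinearMap.congr_fun this c
  refine chain_hom_ext fun x f => ?_
  rw [twistFrom_zero, LinearMap.comp_apply, retractChain, mapChain_tens, mapChain_tens,
    mapChain_tens]
  rfl

/-- On objects satisfying `P` the isomorphism `θ` is only a transport along an equality, so the
retraction is a strict left inverse of the inclusion, without homotopy. -/
theorem retractChain_mapChain (hrP : ∀ x, P x → ∃ h : x = r x, (θ x).hom = eqToHom h) {n : ℕ}
    (c : Chain k P.FullSubcategory n) :
    retractChain P hr θ n (mapChain P.ι.obj (fun _ _ => P.ι.mapLinearMap k) n c) = c := by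
  suffices (retractChain P hr θ n).comp (mapChain P.ι.obj (fun _ _ => P.ι.mapLinearMap k) n) =
      LinearMap.id from LinearMap.congr_fun this c
  refine chain_hom_ext fun x f => ?_
  rw [LinearMap.comp_apply, retractChain, mapChain_tens, mapChain_tens, LinearMap.id_apply]
  have hx : ∀ x : P.FullSubcategory, (⟨r x.obj, hr x.obj⟩ : P.FullSubcategory) = x := fun x => by
    obtain ⟨h, -⟩ := hrP x.obj x.property
    ext
    exact h.symm
  refine tens_congr k (funext fun i => hx (x i)) _ _ fun i => ?_
  obtain ⟨h, e⟩ := hrP _ (x i).property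
  obtain ⟨h', e'⟩ := hrP _ (x (i + 1)).property
  have e'' : (θ (x i).obj).inv = eqToHom h.symm := by
    rw [show θ (x i).obj = eqToIso h from Iso.ext e, eqToIso.inv]
  apply P.ι.map_injective
  simp only [Functor.map_comp, eqToHom_map]
  exact congrArg₂ (fun a b => a ≫ (f i).hom ≫ b) e'' e'

/-- The inclusion of a full subcategory to which every object retracts by a homogeneous
isomorphism induces a quasi-isomorphism of class complexes. -/
theorem quasiIso_inclusion (hid : ∀ x, 𝟙 x ∈ γ.part x x 1)
    (hr : ∀ x, P (r x)) (hrP : ∀ x, P x → ∃ h : x = r x, (θ x).hom = eqToHom h) (e : B → G)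
    (hom_mem : ∀ x, (θ x).hom ∈ γ.part _ _ (e x))
    (inv_mem : ∀ x, (θ x).inv ∈ γ.part _ _ (e x)⁻¹) : QuasiIso (γ.inclusion D P) := by
  -- The prisms mix untwisted vertices, of degree `1`, with twisted ones, of degree `e x`.
  have hom_mem' : ∀ (b : Bool) x, (boolIso θ b x).hom ∈ γ.part _ _ (bif b then e x else 1) := by
    rintro (_ | _) x
    exacts [hid x, hom_mem x]
  have inv_mem' : ∀ (b : Bool) x,
      (boolIso θ b x).inv ∈ γ.part _ _ (bif b then e x else 1)⁻¹ := by
    rintro (_ | _) x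
    · change 𝟙 x ∈ γ.part x x (1 : G)⁻¹
      rw [inv_one]
      exact hid x
    · exact inv_mem x
  have prism_mem : ∀ n, ∀ c ∈ γ.classChain D n, prismSum k θ n c ∈ γ.classChain D (n + 1) := by
    intro n c hc
    simp only [prismSum, LinearMap.sum_apply, LinearMap.smul_apply]
    exact Submodule.sum_mem _ fun j _ => Submodule.smul_mem _ _
      (γ.twist_mem D _ _ hom_mem' inv_mem' _ (γ.degenMap_mem D hid j hc))
  let R : γ.classComplex D ⟶ (γ.restrict P).classComplex D := ChainComplex.ofHom
    (fun n => ModuleCat.ofHom ((retractChain P hr θ n).restrict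
      (p := γ.classChain D n) (q := (γ.restrict P).classChain D n)
      fun c hc => γ.retractChain_mem D P hr e hom_mem inv_mem hc))
    (fun n => by
      rw [classComplex_d, classComplex_d]
      refine ModuleCat.hom_ext (LinearMap.ext fun c => Subtype.ext ?_)
      exact (retractChain_boundary P hr θ n c.1).symm)
  have hR : γ.inclusion D P ≫ R = 𝟙 _ := by
    ext n : 1
    refine ModuleCat.hom_ext (LinearMap.ext fun c => Subtype.ext ?_)
    exact retractChain_mapChain P hr hrP c.1
  let H : Homotopy (𝟙 (γ.classComplex D)) (R ≫ γ.inclusion D P) := homotopyOfComponents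
    (fun n => ModuleCat.ofHom ((prismSum k θ n).restrict
      (p := γ.classChain D n) (q := γ.classChain D (n + 1)) (prism_mem n)))
    (by
      rw [classComplex_d]
      refine ModuleCat.hom_ext (LinearMap.ext fun c => Subtype.ext ?_)
      refine Eq.trans ?_ (congrArg₂ (· + ·) (boundary_prismSum_zero k θ c.1).symm
        (mapChain_retractChain P hr c.1).symm)
      -- A threshold beyond the last vertex twists nothing, whereas threshold `0` twists every
      -- vertex and gives the retraction followed by the inclusion.
      rw [twistFrom_of_lt k θ zero_lt_one, sub_add_cancel]
      rfl)
    (fun n => by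
      rw [classComplex_d, classComplex_d]
      refine ModuleCat.hom_ext (LinearMap.ext fun c => Subtype.ext ?_)
      refine Eq.trans ?_ (congrArg₂ (· + ·) ((add_comm _ _).trans
        (boundary_prismSum_succ k θ n c.1)).symm (mapChain_retractChain P hr c.1).symm)
      rw [twistFrom_of_lt k θ (Nat.lt_succ_self _), sub_add_cancel]
      rfl)
  exact (HomotopyEquiv.mk _ R (Homotopy.ofEq hR) H.symm).quasiIso_hom

end Grading

end HochschildMitchell

/-! ### Translates as morphisms of the skew category. -/

namespace HochschildMitchell

variable {k : Type u} [CommRing k] {G : Type u} [Group G]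
  {C : Type u} [SmallCategory C] [Preadditive C] [Linear k C] [MulAction G C]

/-- The product is a separate variable so that an already simplified form of `s * t` can be
supplied. -/
theorem LinearAction.homMap_homMap [LinearAction k G C] {r s t : G} (h : s * t = r) {x y : C}
    (f : x ⟶ y) : LinearAction.homMap (k := k) s (LinearAction.homMap (k := k) t f) =
      eqToHom (by rw [← h, mul_smul]) ≫ LinearAction.homMap (k := k) r f ≫
        eqToHom (by rw [← h, mul_smul]) := by
  subst h
  simp [LinearAction.homMap_mul]

namespace SkewCategory

variable [LinearAction k G C]

theorem single_comp_single {x y z : SkewCategory k G C} (s t : G) (f : s • x.obj ⟶ y.obj)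
    (g : t • y.obj ⟶ z.obj) :
    (show x ⟶ y from single s f) ≫ (show y ⟶ z from single t g) =
      single (t * s) (eqToHom (mul_smul t s x.obj) ≫ LinearAction.homMap (k := k) t f ≫ g) :=
  compHom_single s t f g

theorem id_eq_single (x : SkewCategory k G C) :
    𝟙 x = (single 1 (eqToHom (one_smul G x.obj)) : Hom k G x x) := rfl

theorem single_mem {x y : SkewCategory k G C} (s : G) (f : s • x.obj ⟶ y.obj) :
    (single s f : Hom k G x y) ∈ (grading k G C).part x y s := ⟨f, rfl⟩

theorem ofTranslate_mem {x y : SkewCategory k G C} (s t : G) (f : s • x.obj ⟶ t • y.obj) :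
    ofTranslate s t f ∈ (grading k G C).part x y (t⁻¹ * s) := single_mem _ _

theorem id_mem (x : SkewCategory k G C) : 𝟙 x ∈ (grading k G C).part x x 1 := single_mem _ _

/-- The degrees multiply to `(r⁻¹ * t) * (t⁻¹ * s) = r⁻¹ * s`, and the skew composition translates
the first morphism by `(r⁻¹ * t) * t⁻¹ = r⁻¹`. -/
theorem ofTranslate_comp {x y z : SkewCategory k G C} (s t r : G) (f : s • x.obj ⟶ t • y.obj)
    (g : t • y.obj ⟶ r • z.obj) :
    ofTranslate s t f ≫ ofTranslate t r g = ofTranslate s r (f ≫ g) := by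
  refine (single_comp_single _ _ _ _).trans (single_congr (by group) _ _ ?_)
  simp [LinearAction.homMap_comp, LinearAction.homMap_eqToHom,
    LinearAction.homMap_homMap (mul_inv_cancel_right r⁻¹ t)]

theorem ofTranslate_id {x : SkewCategory k G C} (s : G) :
    ofTranslate s s (𝟙 (s • x.obj)) = 𝟙 x := by
  refine (single_congr (inv_mul_cancel s) _ _ ?_).trans (id_eq_single x).symm
  simp [LinearAction.homMap_id]

/-- `ofTranslate s t` as a linear map. -/
noncomputable def ofTranslateLinear (x y : SkewCategory k G C) (s t : G) :
    (s • x.obj ⟶ t • y.obj) →ₗ[k] (x ⟶ y) where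
  toFun := ofTranslate s t
  map_add' f g := by
    simp only [ofTranslate, map_add, Preadditive.add_comp, Preadditive.comp_add, single]
  map_smul' c f := by
    simp only [ofTranslate, map_smul, Linear.smul_comp, Linear.comp_smul, single]
    rfl

/-- The action of `G` does not change the morphism of the skew category. -/
theorem ofTranslate_homMap {x y : SkewCategory k G C} (r s t : G) (f : s • x.obj ⟶ t • y.obj) :
    ofTranslate (r * s) (r * t) (eqToHom (mul_smul r s x.obj) ≫
      LinearAction.homMap (k := k) r f ≫ eqToHom (mul_smul r t y.obj).symm) =
      ofTranslate s t f := by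
  refine single_congr (by group) _ _ ?_
  simp [LinearAction.homMap_comp, LinearAction.homMap_eqToHom,
    LinearAction.homMap_homMap (show (r * t)⁻¹ * r = t⁻¹ by group)]

/-- A morphism of degree `s`, translated by `t`. -/
theorem ofTranslate_single {x y : SkewCategory k G C} (s t r : G) (h : t * s = r)
    (f : s • x.obj ⟶ y.obj) :
    ofTranslate r t (eqToHom (by rw [← h, mul_smul]) ≫ LinearAction.homMap (k := k) t f) =
      (single s f : Hom k G x y) := by
  subst h
  refine single_congr (by group) _ _ ?_
  simp [LinearAction.homMap_comp, LinearAction.homMap_eqToHom, LinearAction.homMap_one,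
    LinearAction.homMap_homMap (inv_mul_cancel t)]

end SkewCategory

end HochschildMitchell

namespace HochschildMitchell

/-! ### Transversals of a free action and telescoping sequences. -/

section Transversal

variable {G : Type u} [Group G]

theorem exists_transversal (G : Type u) [Group G] (E : Type u) [MulAction G E] :
    ∃ T : Set E, IsTransversal G T := by
  refine ⟨Set.range fun q : MulAction.orbitRel.Quotient G E => q.out, fun x =>
    ⟨(Quotient.mk'' x : MulAction.orbitRel.Quotient G E).out, ⟨⟨_, rfl⟩, ?_⟩, ?_⟩⟩
  · exact MulAction.orbitRel_apply.1 (Quotient.mk_out (s := MulAction.orbitRel G E) x)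
  · rintro _ ⟨⟨q, rfl⟩, h⟩
    congr 1
    rw [← Quotient.out_eq' q]
    exact Quotient.sound' (MulAction.orbitRel_apply.2 h)

/-- Transversality determines `ρ`, and freeness determines `σ`. All later uses of freeness pass
through this lemma. -/
theorem IsTransversal.exists_section {E : Type u} [MulAction G E]
    (hfree : ∀ (s : G) (x : E), s • x = x → s = 1) {T : Set E} (hT : IsTransversal G T) :
    ∃ (ρ : E → E) (σ : E → G), (∀ x, ρ x ∈ T) ∧ (∀ x, σ x • ρ x = x) ∧
      ∀ (s : G), ∀ v ∈ T, ρ (s • v) = v ∧ σ (s • v) = s := by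
  have h : ∀ x, ∃ (v : E) (s : G), v ∈ T ∧ s • v = x := fun x => by
    obtain ⟨_, ⟨hu, ⟨g, rfl⟩⟩, -⟩ := hT x
    exact ⟨g • x, g⁻¹, hu, inv_smul_smul g x⟩
  choose ρ σ hρ hσ using h
  refine ⟨ρ, σ, hρ, hσ, fun s v hv => ?_⟩
  have e : ρ (s • v) = v := by
    refine (hT v).unique ⟨hρ _, (σ (s • v))⁻¹ * s, ?_⟩ ⟨hv, MulAction.mem_orbit_self v⟩
    change ((σ (s • v))⁻¹ * s) • v = _
    rw [mul_smul, inv_smul_eq_iff, hσ]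
  refine ⟨e, ?_⟩
  have h' := hσ (s • v)
  rw [e] at h'
  -- Both `s` and `σ (s • v)` carry `v` to `s • v`, so their quotient fixes `v`.
  have := hfree (s⁻¹ * σ (s • v)) v (by rw [mul_smul, h', inv_smul_smul])
  rw [inv_mul_eq_one] at this
  exact this.symm

end Transversal

section Telescoping

variable {G : Type u} [Group G] {n : ℕ}

/-- The sequence starts at `1` and continues by right multiplication with the inverses of the `p i`;
the second clause records the accumulated product, needed to close the cycle. -/
theorem exists_quotients_castSucc (p : Fin n → G) :
    ∃ t : Fin (n + 1) → G, (∀ i : Fin n, t i.succ * p i = t i.castSucc) ∧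
      t (Fin.last n) * revProd p = t 0 := by
  induction n with
  | zero => exact ⟨1, fun i => i.elim0, by simp [revProd]⟩
  | succ n ih =>
    obtain ⟨t, ht, ht'⟩ := ih fun i => p i.castSucc
    refine ⟨Fin.snoc t (t (Fin.last n) * (p (Fin.last n))⁻¹), fun i => ?_, ?_⟩
    · refine Fin.lastCases ?_ (fun i => ?_) i
      · simp
      · rw [Fin.succ_castSucc, Fin.snoc_castSucc, Fin.snoc_castSucc, ht]
    · rw [revProd_succ', Fin.snoc_last, ← Fin.castSucc_zero, Fin.snoc_castSucc, ← ht']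
      group

/-- A cyclic sequence with product `1` consists of quotients of consecutive terms. -/
theorem exists_quotients (p : Fin (n + 1) → G) (hp : revProd p = 1) :
    ∃ t : Fin (n + 1) → G, ∀ i, t (i + 1) * p i = t i := by
  obtain ⟨t, ht, ht'⟩ := exists_quotients_castSucc fun i => p i.castSucc
  refine ⟨t, fun i => ?_⟩
  refine Fin.lastCases ?_ (fun i => ?_) i
  -- The closing relation from the last index back to `0` is where the product being `1` is used.
  · rw [Fin.last_add_one, ← ht', mul_assoc, mul_eq_left]
    rw [revProd_succ'] at hp
    exact mul_eq_one_comm.1 hp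
  · rw [Fin.coeSucc_eq_succ, ht]

/-- This is `revProd_conj` for the constant sequence `1` with conjugating elements `(t i)⁻¹`. -/
theorem revProd_quotients (t : Fin (n + 1) → G) : revProd (fun i => (t (i + 1))⁻¹ * t i) = 1 := by
  simpa [revProd] using revProd_conj (fun i => (t i)⁻¹) fun _ => 1

theorem eq_apply_zero_of_add_one {X : Type*} {a : Fin (n + 1) → X} (h : ∀ i, a (i + 1) = a i)
    (i : Fin (n + 1)) : a i = a 0 := by
  refine Fin.induction (motive := fun i => a i = a 0) rfl (fun i ih => ?_) i
  rw [← Fin.coeSucc_eq_succ, h, ih]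

end Telescoping

variable {k : Type u} [CommRing k] {G : Type u} [Group G]
  {C : Type u} [SmallCategory C] [Preadditive C] [Linear k C] [MulAction G C]
  [LinearAction k G C]

open SkewCategory

/-! ### The inclusion of `C_T[G]` is a quasi-isomorphism. -/

section QuasiIso

theorem ofTranslate_one_eqToHom {x y : SkewCategory k G C} (h : x = y) {t : G} (ht : t = 1)
    (e : (1 : G) • x.obj = t • y.obj) : ofTranslate 1 t (eqToHom e) = eqToHom h := by
  subst h ht
  exact ofTranslate_id 1

/-- Objects of the skew category that lie in the same orbit are isomorphic. -/
noncomputable def translateIso (x y : SkewCategory k G C) (s t : G)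
    (h : s • x.obj = t • y.obj) : x ≅ y where
  hom := ofTranslate s t (eqToHom h)
  inv := ofTranslate t s (eqToHom h.symm)
  hom_inv_id := by
    rw [ofTranslate_comp, eqToHom_trans]
    exact ofTranslate_id s
  inv_hom_id := by
    rw [ofTranslate_comp, eqToHom_trans]
    exact ofTranslate_id t

/-- The equality `1 • x = σ x • ρ x` gives an isomorphism from `x` to `ρ x` of degree `(σ x)⁻¹`,
which is the retraction datum required by `Grading.quasiIso_inclusion`. -/
theorem quasiIso_transversalInclusion (hfree : ∀ (s : G) (x : C), s • x = x → s = 1) {T : Set C}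
    (hT : IsTransversal G T) : QuasiIso (transversalInclusion k G T) := by
  obtain ⟨ρ, σ, hρ, hσ, h⟩ := hT.exists_section hfree
  refine Grading.quasiIso_inclusion _ _ _ (r := fun X => ⟨ρ X.obj⟩)
    (θ := fun X => translateIso X ⟨ρ X.obj⟩ 1 (σ X.obj) ((one_smul G _).trans (hσ _).symm))
    id_mem (fun X => hρ X.obj) (fun X hX => ?_) (fun X => (σ X.obj)⁻¹ * 1)
    (fun X => ofTranslate_mem _ _ _) (fun X => ?_)
  · have h1 := h 1 X.obj hX
    rw [one_smul] at h1
    have e : X = ⟨ρ X.obj⟩ := by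
      rw [h1.1]
    exact ⟨e, ofTranslate_one_eqToHom e h1.2 _⟩
  · have := ofTranslate_mem (k := k) (x := ⟨ρ X.obj⟩) (y := X) (σ X.obj) 1
      (eqToHom ((one_smul G _).trans (hσ _).symm).symm)
    rw [show ((σ X.obj)⁻¹ * 1)⁻¹ = 1⁻¹ * σ X.obj by group]
    exact this

end QuasiIso

end HochschildMitchell

namespace HochschildMitchell

open SkewCategory

/-! ### Coinvariant chains of `C` and chains of class `{1}` of `C_T[G]`. -/

section Coinvariants

variable {k : Type u} [CommRing k] {G : Type u} [Group G]
  {C : Type u} [SmallCategory C] [Preadditive C] [Linear k C] [MulAction G C]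
  [LinearAction k G C] {T : Set C} {n : ℕ}

/-- The family of translates `s i • u i` of objects of `T`. -/
abbrev translates (u : Fin (n + 1) → (onSet k G T).FullSubcategory) (s : Fin (n + 1) → G) :
    Fin (n + 1) → C := fun i => s i • (u i).obj.obj

/-- The closed path of the skew category given by a closed path in `C` through translates. -/
noncomputable def skewPath (u : Fin (n + 1) → (onSet k G T).FullSubcategory) (s : Fin (n + 1) → G)
    (f : ∀ i, translates u s i ⟶ translates u s (i + 1)) (i : Fin (n + 1)) : u i ⟶ u (i + 1) :=
  ObjectProperty.homMk (ofTranslate (s i) (s (i + 1)) (f i))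

/-- The closed path `r • f`, through the translates `t i • u i` with `t i = r * s i`. -/
noncomputable def translatePath (u : Fin (n + 1) → (onSet k G T).FullSubcategory)
    {s t : Fin (n + 1) → G} {r : G} (h : ∀ i, r * s i = t i)
    (f : ∀ i, translates u s i ⟶ translates u s (i + 1)) (i : Fin (n + 1)) :
    translates u t i ⟶ translates u t (i + 1) :=
  eqToHom (by rw [translates, ← h, mul_smul]) ≫ LinearAction.homMap (k := k) r (f i) ≫
    eqToHom (by rw [translates, translates, ← h (i + 1), mul_smul])

theorem skewPath_translatePath (u : Fin (n + 1) → (onSet k G T).FullSubcategory)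
    {s t : Fin (n + 1) → G} {r : G} (h : ∀ i, r * s i = t i)
    (f : ∀ i, translates u s i ⟶ translates u s (i + 1)) :
    skewPath u t (translatePath u h f) = skewPath u s f := by
  obtain rfl : (fun i => r * s i) = t := funext h
  funext i
  exact congrArg ObjectProperty.homMk (ofTranslate_homMap r (s i) (s (i + 1)) (f i))

theorem chainRep_tens_translates (u : Fin (n + 1) → (onSet k G T).FullSubcategory)
    {s t : Fin (n + 1) → G} {r : G} (h : ∀ i, r * s i = t i)
    (f : ∀ i, translates u s i ⟶ translates u s (i + 1)) :
    chainRep k G C n r (tens k f) = tens k (translatePath u h f) := by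
  refine (mapChain_tens _ _ f).trans (tens_congr k (funext fun i => ?_) _ _ fun i => ?_)
  · simp only [translates, ← h, mul_smul]
  · simp [translatePath]

theorem skewPath_mem (u : Fin (n + 1) → (onSet k G T).FullSubcategory) (s : Fin (n + 1) → G)
    (f : ∀ i, translates u s i ⟶ translates u s (i + 1)) (i : Fin (n + 1)) :
    skewPath u s f i ∈ (transversalGrading k G T).part _ _ ((s (i + 1))⁻¹ * s i) :=
  ofTranslate_mem _ _ (f i)

theorem tens_skewPath_mem (u : Fin (n + 1) → (onSet k G T).FullSubcategory)
    (s : Fin (n + 1) → G) (f : ∀ i, translates u s i ⟶ translates u s (i + 1)) :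
    tens k (skewPath u s f) ∈ (transversalGrading k G T).classChain (ConjClasses.mk 1) n :=
  (transversalGrading k G T).tens_mem_classChain _ (skewPath_mem u s f)
    (congrArg _ (revProd_quotients s))

/-- Every closed path of homogeneous morphisms in `C_T[G]` whose degrees have product `1` comes
from a closed path in `C`. -/
theorem exists_eq_skewPath (u : Fin (n + 1) → (onSet k G T).FullSubcategory)
    {p t : Fin (n + 1) → G} (ht : ∀ i, t (i + 1) * p i = t i) (g : ∀ i, u i ⟶ u (i + 1))
    (hg : ∀ i, g i ∈ (transversalGrading k G T).part _ _ (p i)) :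
    ∃ f : ∀ i, translates u t i ⟶ translates u t (i + 1), skewPath u t f = g := by
  choose f hf using hg
  -- The component of `g i` goes from `p i • u i` to `u (i + 1)`; translation by `t (i + 1)` makes
  -- its source `t i • u i`, so consecutive morphisms match.
  refine ⟨fun i => eqToHom (by rw [translates, ← ht, mul_smul]) ≫
    LinearAction.homMap (k := k) (t (i + 1)) (f i), funext fun i => ?_⟩
  ext
  exact (ofTranslate_single (p i) (t (i + 1)) (t i) (ht i) (f i)).trans (hf i)

section Section

variable {ρ : C → C} {σ : C → G} (hρ : ∀ x, ρ x ∈ T) (hσ : ∀ x, σ x • ρ x = x)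

/-- The map from `C` to `C_T[G]` on morphisms. -/
noncomputable def toTransversalHom (x y : C) :
    (x ⟶ y) →ₗ[k] ((⟨⟨ρ x⟩, hρ x⟩ : (onSet k G T).FullSubcategory) ⟶ ⟨⟨ρ y⟩, hρ y⟩) where
  toFun f := ObjectProperty.homMk
    (ofTranslate (σ x) (σ y) (eqToHom (hσ x) ≫ f ≫ eqToHom (hσ y).symm))
  map_add' f g := by
    ext
    simp only [Preadditive.add_comp, Preadditive.comp_add]
    exact (ofTranslateLinear _ _ _ _).map_add _ _
  map_smul' c f := by
    ext
    simp only [Linear.smul_comp, Linear.comp_smul]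
    exact (ofTranslateLinear _ _ _ _).map_smul _ _

theorem toTransversalHom_comp {x y z : C} (f : x ⟶ y) (g : y ⟶ z) :
    toTransversalHom (k := k) hρ hσ x z (f ≫ g) =
      toTransversalHom hρ hσ x y f ≫ toTransversalHom hρ hσ y z g := by
  ext
  refine Eq.trans ?_ (ofTranslate_comp _ _ _ _ _).symm
  simp [toTransversalHom]

theorem homMk_ofTranslate_congr {u u' v v' : (onSet k G T).FullSubcategory} {s s' t t' : G}
    (hu : u' = u) (hv : v' = v) (hs : s' = s) (ht : t' = t)
    (eu : s' • u'.obj.obj = s • u.obj.obj) (ev : t • v.obj.obj = t' • v'.obj.obj)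
    (f : s • u.obj.obj ⟶ t • v.obj.obj) :
    (ObjectProperty.homMk (ofTranslate s' t' (eqToHom eu ≫ f ≫ eqToHom ev)) : u' ⟶ v') =
      eqToHom hu ≫ ObjectProperty.homMk (ofTranslate s t f) ≫ eqToHom hv.symm := by
  subst hu hv hs ht
  simp

/-- The map from the chains of `C` to the chains of `C_T[G]`. -/
noncomputable def toTransversalChain (n : ℕ) :
    Chain k C n →ₗ[k] Chain k (onSet k G T).FullSubcategory n :=
  mapChain (fun x => ⟨⟨ρ x⟩, hρ x⟩) (toTransversalHom hρ hσ) n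

theorem toTransversalChain_tens (h : ∀ (s : G), ∀ v ∈ T, ρ (s • v) = v ∧ σ (s • v) = s)
    (u : Fin (n + 1) → (onSet k G T).FullSubcategory) (s : Fin (n + 1) → G)
    (f : ∀ i, translates u s i ⟶ translates u s (i + 1)) :
    toTransversalChain hρ hσ n (tens k f) = tens k (skewPath u s f) := by
  have hu : ∀ i, (⟨⟨ρ (translates u s i)⟩, hρ _⟩ : (onSet k G T).FullSubcategory) = u i := by
    intro i
    ext
    exact congrArg SkewCategory.mk (h (s i) _ (u i).property).1
  refine (mapChain_tens _ _ f).trans (tens_congr k (funext hu) _ _ fun i => ?_)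
  exact homMk_ofTranslate_congr (hu i) (hu (i + 1)) (h (s i) _ (u i).property).2
    (h (s (i + 1)) _ (u (i + 1)).property).2 _ _ (f i)

/-- Every object is a translate `σ x • ρ x`, so the closed paths through translates already give all
elementary chains. -/
theorem chain_hom_ext_translates (hρ : ∀ x, ρ x ∈ T) (hσ : ∀ x, σ x • ρ x = x) {M : Type*}
    [AddCommGroup M] [Module k M] {φ ψ : Chain k C n →ₗ[k] M}
    (h : ∀ (u : Fin (n + 1) → (onSet k G T).FullSubcategory) (s : Fin (n + 1) → G)
      (f : ∀ i, translates u s i ⟶ translates u s (i + 1)), φ (tens k f) = ψ (tens k f)) :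
    φ = ψ := by
  refine chain_hom_ext fun x f => ?_
  have e := tens_congr k (funext fun i => (hσ (x i)).symm) f
    (fun i => eqToHom (hσ (x i)) ≫ f i ≫ eqToHom (hσ (x (i + 1))).symm) fun i => by simp
  rw [e]
  exact h (fun i => ⟨⟨ρ (x i)⟩, hρ (x i)⟩) (fun i => σ (x i)) _

theorem toTransversalChain_mem (h : ∀ (s : G), ∀ v ∈ T, ρ (s • v) = v ∧ σ (s • v) = s)
    (c : Chain k C n) : toTransversalChain hρ hσ n c ∈
      (transversalGrading k G T).classChain (ConjClasses.mk 1) n := by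
  -- Membership is recast as the vanishing of a linear map to the quotient, so that extensionality
  -- on paths through translates applies.
  suffices ((transversalGrading k G T).classChain (ConjClasses.mk 1) n).mkQ.comp
      (toTransversalChain hρ hσ n) = 0 from
    (Submodule.Quotient.mk_eq_zero _).1 (LinearMap.congr_fun this c)
  refine chain_hom_ext_translates hρ hσ fun u s f => ?_
  rw [LinearMap.comp_apply, toTransversalChain_tens hρ hσ h]
  exact (Submodule.Quotient.mk_eq_zero _).2 (tens_skewPath_mem u s f)

theorem toTransversalChain_chainRep (h : ∀ (s : G), ∀ v ∈ T, ρ (s • v) = v ∧ σ (s • v) = s)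
    (r : G) (c : Chain k C n) :
    toTransversalChain (k := k) hρ hσ n (chainRep k G C n r c) = toTransversalChain hρ hσ n c := by
  suffices (toTransversalChain (k := k) hρ hσ n).comp (chainRep k G C n r) =
      toTransversalChain hρ hσ n from LinearMap.congr_fun this c
  refine chain_hom_ext_translates hρ hσ fun u s f => ?_
  rw [LinearMap.comp_apply, chainRep_tens_translates u (t := fun i => r * s i) (fun _ => rfl),
    toTransversalChain_tens hρ hσ h, toTransversalChain_tens hρ hσ h, skewPath_translatePath]

/-- The map from the coinvariants of the chains of `C` to the chains of class `{1}` of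
`C_T[G]`. -/
noncomputable def coinvariantsToChain
    (h : ∀ (s : G), ∀ v ∈ T, ρ (s • v) = v ∧ σ (s • v) = s) (n : ℕ) :
    (chainRep k G C n).Coinvariants →ₗ[k]
      (transversalGrading k G T).classChain (ConjClasses.mk 1) n :=
  Representation.Coinvariants.lift (chainRep k G C n)
    (W := (transversalGrading k G T).classChain (ConjClasses.mk 1) n)
    ((toTransversalChain hρ hσ n).codRestrict
      ((transversalGrading k G T).classChain (ConjClasses.mk 1) n)
      (toTransversalChain_mem hρ hσ h))
    fun r => LinearMap.ext fun c => Subtype.ext (toTransversalChain_chainRep hρ hσ h r c)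

theorem coinvariantsToChain_surjective
    (h : ∀ (s : G), ∀ v ∈ T, ρ (s • v) = v ∧ σ (s • v) = s) :
    Function.Surjective (coinvariantsToChain (k := k) hρ hσ h n) := by
  rintro ⟨c, hc⟩
  suffices c ∈ LinearMap.range (toTransversalChain (k := k) hρ hσ n) by
    obtain ⟨b, rfl⟩ := this
    exact ⟨Representation.Coinvariants.mk _ b, rfl⟩
  refine (transversalGrading k G T).map_mem_of_mem_classChain _ LinearMap.id _
    (fun u g p hg hp => ?_) hc
  -- The conjugacy class of `1` is a singleton, so the product of the degrees is exactly `1` and the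
  -- degrees are quotients.
  rw [ConjClasses.mk_eq_mk_iff_isConj, isConj_one_left] at hp
  obtain ⟨t, ht⟩ := exists_quotients p hp
  obtain ⟨f, rfl⟩ := exists_eq_skewPath u ht g hg
  exact ⟨_, toTransversalChain_tens hρ hσ h u t f⟩

end Section

open Classical in
/-- The component of degrees `p` of the inverse of `coinvariantsToChain`. -/
noncomputable def translateBack (u : Fin (n + 1) → (onSet k G T).FullSubcategory)
    (p : Fin (n + 1) → G) :
    MultilinearMap k (fun i => (p i • (u i).obj.obj ⟶ (u (i + 1)).obj.obj))
      (chainRep k G C n).Coinvariants :=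
  -- Any solution `t` will do: two solutions differ by one left factor, which is invisible in the
  -- coinvariants. The value `0` elsewhere is harmless, since only chains of class `{1}` matter.
  if h : ∃ t : Fin (n + 1) → G, ∀ i, t (i + 1) * p i = t i then
    ((Representation.Coinvariants.mk (chainRep k G C n)).compMultilinearMap
      (tensMultilinear k (translates u h.choose))).compLinearMap fun i =>
        (Linear.leftComp k _ (eqToHom (by rw [translates, ← h.choose_spec i, mul_smul]))).comp
          (LinearAction.homMap (k := k) (h.choose (i + 1)))
  else 0

variable (k T) in
/-- The inverse of `coinvariantsToChain`, extended by zero. -/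
noncomputable def chainToCoinvariants (n : ℕ) :
    Chain k (onSet k G T).FullSubcategory n →ₗ[k] (chainRep k G C n).Coinvariants :=
  liftChain k fun u =>
    (MultilinearMap.fromDirectSumEquiv (translateBack u)).compLinearMap
      fun _ => (onSet k G T).ι.mapLinearMap k

theorem chainToCoinvariants_skewPath (u : Fin (n + 1) → (onSet k G T).FullSubcategory)
    (s : Fin (n + 1) → G) (f : ∀ i, translates u s i ⟶ translates u s (i + 1)) :
    chainToCoinvariants k T n (tens k (skewPath u s f)) =
      Representation.Coinvariants.mk _ (tens k f) := by
  classical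
  have h : ∃ t : Fin (n + 1) → G, ∀ i, t (i + 1) * ((s (i + 1))⁻¹ * s i) = t i :=
    ⟨s, fun i => mul_inv_cancel_left _ _⟩
  -- The chosen solution and `s` have the same successive quotients, so `h.choose i * (s i)⁻¹` is
  -- constant around the cycle. Translating `f` by this constant gives the chosen lift.
  have e : ∀ i, h.choose 0 * (s 0)⁻¹ * s i = h.choose i := fun i => by
    rw [← eq_apply_zero_of_add_one (a := fun i => h.choose i * (s i)⁻¹) _ i, inv_mul_cancel_right]
    intro i
    conv_rhs => rw [← h.choose_spec i]
    group
  rw [← Representation.Coinvariants.mk_self_apply _ (h.choose 0 * (s 0)⁻¹) (tens k f),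
    chainRep_tens_translates u e, chainToCoinvariants, liftChain_tens]
  -- Each morphism of the path is homogeneous, so just one tuple of degrees contributes.
  refine (MultilinearMap.fromDirectSumEquiv_lof (R := k) (κ := fun _ => G)
    (M := fun i s => (s • (u i).obj.obj ⟶ (u (i + 1)).obj.obj)) (translateBack u)
    (fun i => (s (i + 1))⁻¹ * s i) _).trans ?_
  rw [translateBack, dif_pos h]
  refine congrArg (fun g => Representation.Coinvariants.mk _ (tens k g)) (funext fun i => ?_)
  simp [translatePath, LinearAction.homMap_comp, LinearAction.homMap_eqToHom]
  rw [LinearAction.homMap_homMap (r := h.choose 0 * (s 0)⁻¹)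
    (by rw [← e (i + 1), mul_inv_cancel_right])]
  simp

theorem coinvariantsToChain_injective {ρ : C → C} {σ : C → G} (hρ : ∀ x, ρ x ∈ T)
    (hσ : ∀ x, σ x • ρ x = x) (h : ∀ (s : G), ∀ v ∈ T, ρ (s • v) = v ∧ σ (s • v) = s) :
    Function.Injective (coinvariantsToChain (k := k) hρ hσ h n) := by
  suffices (chainToCoinvariants k T n ∘ₗ Submodule.subtype _) ∘ₗ coinvariantsToChain hρ hσ h n =
      LinearMap.id from Function.LeftInverse.injective
        (g := chainToCoinvariants k T n ∘ₗ Submodule.subtype _) (LinearMap.congr_fun this)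
  refine Representation.Coinvariants.hom_ext (chain_hom_ext_translates hρ hσ fun u s f => ?_)
  refine Eq.trans ?_ (chainToCoinvariants_skewPath u s f)
  exact congrArg (chainToCoinvariants k T n) (toTransversalChain_tens hρ hσ h u s f)

end Coinvariants

end HochschildMitchell

namespace HochschildMitchell

open SkewCategory

/-! ### Passage to complexes and homology. -/

section Complexes

variable {k : Type u} [CommRing k] {G : Type u} [Group G]
  {C : Type u} [SmallCategory C] [Preadditive C] [Linear k C] [MulAction G C]
  [LinearAction k G C] {T : Set C}

theorem toTransversalChain_boundary {ρ : C → C} {σ : C → G} (hρ : ∀ x, ρ x ∈ T)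
    (hσ : ∀ x, σ x • ρ x = x) (n : ℕ) (c : Chain k C (n + 1)) :
    toTransversalChain hρ hσ n (boundary k n c) =
      boundary k n (toTransversalChain hρ hσ (n + 1) c) :=
  mapChain_boundary _ _ (toTransversalHom_comp hρ hσ) n c

theorem coinvariantsComplex_d_mk (n : ℕ) (c : Chain k C (n + 1)) :
    (coinvariantsComplex k G C).d (n + 1) n
      (Representation.Coinvariants.mk (chainRep k G C (n + 1)) c) =
      Representation.Coinvariants.mk (chainRep k G C n) (boundary k n c) := by
  have : (chainComplex k G C).d (n + 1) n = Rep.ofHom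
      { toLinearMap := boundary k n
        isIntertwining' := fun s => LinearMap.ext fun c =>
          (mapChain_boundary (fun x : C => s • x) (fun _ _ => LinearAction.homMap s)
            (LinearAction.homMap_comp s) n c).symm } := by
    unfold chainComplex
    simp
  change (Rep.coinvariantsFunctor k G).map ((chainComplex k G C).d (n + 1) n)
      (Representation.Coinvariants.mk (chainRep k G C (n + 1)) c) = _
  rw [this]
  rfl

variable (k) in
/-- The isomorphism from the complex of coinvariants to the complex of chains of class `{1}` of
`C_T[G]`. -/
noncomputable def coinvariantsIso {ρ : C → C} {σ : C → G} (hρ : ∀ x, ρ x ∈ T)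
    (hσ : ∀ x, σ x • ρ x = x) (h : ∀ (s : G), ∀ v ∈ T, ρ (s • v) = v ∧ σ (s • v) = s) :
    coinvariantsComplex k G C ≅ transversalComplex k G T :=
  HomologicalComplex.Hom.isoOfComponents
    (fun n => (LinearEquiv.ofBijective (coinvariantsToChain (k := k) hρ hσ h n)
      ⟨coinvariantsToChain_injective hρ hσ h,
        coinvariantsToChain_surjective hρ hσ h⟩).toModuleIso)
    (by
      rintro _ n rfl
      refine ModuleCat.hom_ext (LinearMap.ext fun c => ?_)
      obtain ⟨c, rfl⟩ := Representation.Coinvariants.mk_surjective _ c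
      refine Subtype.ext ?_
      refine Eq.trans ?_ (congrArg (fun c => (coinvariantsToChain hρ hσ h n c).1)
        (coinvariantsComplex_d_mk n c).symm)
      rw [Grading.classComplex_d]
      exact (toTransversalChain_boundary hρ hσ n c).symm)

end Complexes

variable {k : Type u} [Field k] {G : Type u} [Group G]
  {C : Type u} [SmallCategory C] [Preadditive C] [Linear k C] [MulAction G C]
  [LinearAction k G C]

/-- An additive functor that preserves short exact sequences preserves homology, so it commutes with
the homology of the chain complex. -/
theorem nonempty_homology_coinvariants_iso (hG : CoinvariantsExact k G) (n : ℕ) :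
    Nonempty ((coinvariantsComplex k G C).homology n ≅
      (Rep.coinvariantsFunctor k G).obj (HochschildMitchell.homology k G C n)) := by
  have : (Rep.coinvariantsFunctor.{u} k G).PreservesHomology :=
    ((Functor.exact_tfae (Rep.coinvariantsFunctor.{u} k G)).out 0 2).1 hG
  exact ⟨((chainComplex k G C).sc n).mapHomologyIso (Rep.coinvariantsFunctor k G)⟩

end HochschildMitchell

theorem mainTheorem6 {k : Type u} [Field k] {G : Type u} [Group G]
    {C : Type u} [SmallCategory C] [Preadditive C] [Linear k C]
    [MulAction G C] [LinearAction k G C]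
    (hfree : ∀ (s : G) (x : C), s • x = x → s = 1) :
    (∀ T : Set C, IsTransversal G T →
      (∃ A : coinvariantsComplex k G C ≅ transversalComplex k G T,
        ∀ (n : ℕ) (u : Fin (n + 1) → (SkewCategory.onSet k G T).FullSubcategory)
          (s : Fin (n + 1) → G)
          (f : ∀ i, s i • (u i).obj.obj ⟶ s (i + 1) • (u (i + 1)).obj.obj),
          (transversalGrading k G T).toChain (ConjClasses.mk 1) n
              (A.hom.f n (coinvariantsTens k G (x := fun i => s i • (u i).obj.obj) f)) =
            tens k (x := u) fun i =>
              ObjectProperty.homMk (SkewCategory.ofTranslate (s i) (s (i + 1)) (f i))) ∧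
      QuasiIso (transversalInclusion k G T)) ∧
    (∀ n : ℕ, Nonempty (skewHomology k G C n ≅ (coinvariantsComplex k G C).homology n)) ∧
    (CoinvariantsExact k G → ∀ n : ℕ,
      Nonempty (skewHomology k G C n ≅
        (Rep.coinvariantsFunctor k G).obj (HochschildMitchell.homology k G C n))) := by
  have h1 : ∀ n : ℕ,
      Nonempty (skewHomology k G C n ≅ (coinvariantsComplex k G C).homology n) := fun n => by
    -- No transversal occurs in this claim; an arbitrary one serves as the intermediary between the
    -- two homologies.
    obtain ⟨T, hT⟩ := exists_transversal G C
    obtain ⟨ρ, σ, hρ, hσ, h⟩ := hT.exists_section hfree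
    have := quasiIso_transversalInclusion (k := k) hfree hT
    exact ⟨(asIso (HomologicalComplex.homologyMap (transversalInclusion k G T) n)).symm ≪≫
      (HomologicalComplex.homologyMapIso (coinvariantsIso k hρ hσ h) n).symm⟩
  refine ⟨fun T hT => ⟨?_, quasiIso_transversalInclusion hfree hT⟩, h1, fun hG n => ?_⟩
  · obtain ⟨ρ, σ, hρ, hσ, h⟩ := hT.exists_section hfree
    exact ⟨coinvariantsIso k hρ hσ h, fun n u s f => toTransversalChain_tens hρ hσ h u s f⟩
  · obtain ⟨e⟩ := h1 n
    obtain ⟨e'⟩ := nonempty_homology_coinvariants_iso (C := C) hG n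
    exact ⟨e ≪≫ e'⟩
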